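/- Let $\mathbb F$ be a totally ordered field and let $n\ge 3$. A line arrangement is a family of lines $L_1,\dots,L_n$ in $\mathbb F^2$, no two parallel and no three concurrent; subscripts are read modulo $n$. **Definitions.** *Anticlockwise $n$-gon.* The lines form an anticlockwise $n$-gon $L_1\to L_2\to\dots\to L_n\to L_1$ if there is a bounded region $R$ (an intersection of closed half-planes, one bounded by each $L_i$, with non-empty interior and containing no half-line) such that for every $i$ the set $L_i\cap R$ is the segment from $L_{i-1}\cap L_i$ to $L_i\cap L_{i+1}$, no other line of the arrangement meets this segment between its end points, and $R$ lies on the left when this segment is traversed from $L_{i-1}\cap L_i$ to $L_i\cap L_{i+1}$. *Cycle at infinity.* Let $M: ax+by=c$, $c>0$, be a line parallel to none of the $L_i$ such that every intersection point of two lines of the arrangement satisfies $ax+by<c$. Orient $M$ so that the origin is on its left. If $L_{i_1},\dots,L_{i_n}$ is the order in which the lines meet $M$, the cycle at infinity is the $n$-cycle $\sigma=(i_1\,i_2\,\dots\,i_n)\in S_n$. *2-standard consecutive structure.* An $n$-cycle, written as $(a_1=1,a_2,\dots,a_n)$, has the 2-standard consecutive structure $1<2<\dots<j$, $j+1<\dots<n$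 (with $1\le j<n$) if $1,2,\dots,j$ occur from left to right in this order, $j+1,\dots,n$ occur from left to right in this order, and $(a_1,\dots,a_n)\ne(1,2,\dots,n)$. *Slope order and slope property.* The slope order $\prec$ on $\mathbb F\cup\{\infty\}$ is $0\to\infty\to-\infty\to 0$: first the slopes in $[0,\infty]$ in increasing order, then the negative slopes in increasing order. The above structure respects the slope property if, after a suitable rotation of the plane about the origin (possibly followed by a dilation, which does not change slopes), the slopes $m_1,\dots,m_n$ of $L_1,\dots,L_n$ satisfy $0\le m_1$, $m_1\prec m_2\prec\dots\prec m_j$, $m_{j+1}\prec\dots\prec m_n$, and $m_1\prec m_{j+1}\prec m_j$. *Opposite vertex.* $L_j\cap L_{j+1}$ is the opposite vertex of the side $L_1$ if, for some such rotation and some $1\le j<n$, the slopes satisfy the same conditions. The opposite vertex of the side $L_k$ is defined in the same way after the lines are renumbered cyclically so that $L_k$ comes first. *Isomorphism.* Two arrangements are isomorphic if some piecewise linear automorphism of $\mathbb F^2$ takes the set of lines of the first to the set of lines of the second. **Theorem.** Let the line arrangement $L_1,\dots,L_n$ form an anticlockwise $n$-gon $L_1\to L_2\to\dots\to L_n\to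 L_1$. 1. The cycle at infinity $\sigma$ exists and is unique, and every side $L_k$ has exactly one opposite vertex $L_j\cap L_{j+1}$. 2. For every $k$, renumber the lines cyclically as $L_k,L_{k+1},\dots,L_{k-1}$. The correspondingly conjugated cycle at infinity has exactly one 2-standard consecutive structure $1<\dots<s$, $s+1<\dots<n$. This structure respects the slope property, and the opposite vertex of $L_k$ is $L_{k+s-1}\cap L_{k+s}$. Thus the cycle at infinity determines the opposite vertex of every side. 3. Let $L'_1,\dots,L'_n$ be another line arrangement over $\mathbb F$ that forms an anticlockwise $n$-gon $L'_1\to\dots\to L'_n\to L'_1$. If the two arrangements have the same cycle at infinity, then for every $k$ the opposite vertices of $L_k$ and of $L'_k$ have the same subscripts. Conversely, if for every $k$ the opposite vertices of $L_k$ and of $L'_k$ have the same subscripts, then the two cycles at infinity are equal and the two arrangements are isomorphic. -/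

import Mathlib

namespace LineArr

/-- A line `a x + b y = c` in the plane `F × F`, given by an equation. -/
structure PlaneLine (F : Type*) [Field F] where
  a : F
  b : F
  c : F
  ne_zero : a ≠ 0 ∨ b ≠ 0

section Basic

variable {F : Type*} [Field F]

/-- The set of points of a line. -/
def PlaneLine.points (L : PlaneLine F) : Set (F × F) :=
  {p | L.a * p.1 + L.b * p.2 = L.c}

/-- Two lines have the same direction (this includes coinciding lines). -/
def PlaneLine.Parallel (L M : PlaneLine F) : Prop :=
  L.a * M.b = M.a * L.b

/-- Lines in generic position: no two are parallel, no three are concurrent. -/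
structure IsLineArrangement {n : ℕ} (ℒ : Fin n → PlaneLine F) : Prop where
  not_parallel : ∀ i j, i ≠ j → ¬ (ℒ i).Parallel (ℒ j)
  not_concurrent : ∀ i j k, i ≠ j → i ≠ k → j ≠ k →
    (ℒ i).points ∩ (ℒ j).points ∩ (ℒ k).points = ∅

open Classical in
/-- The slope of a line, in `F ∪ {∞}`; the vertical lines have slope `∞ = ⊤`. -/
noncomputable def PlaneLine.slope (L : PlaneLine F) : WithTop F :=
  if L.b = 0 then ⊤ else ((-L.a / L.b : F) : WithTop F)

end Basic

variable {F : Type*} [Field F] [LinearOrder F] [IsStrictOrderedRing F]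

/-! ### Regions and polygons -/

/-- A region of the arrangement: for each line one of the two closed half planes is chosen,
and the intersection of these has a point at which all the inequalities are strict. -/
def IsRegion {n : ℕ} (ℒ : Fin n → PlaneLine F) (R : Set (F × F)) : Prop :=
  ∃ ε : Fin n → F, (∀ i, ε i = 1 ∨ ε i = -1) ∧
    R = {p | ∀ i, 0 ≤ ε i * ((ℒ i).a * p.1 + (ℒ i).b * p.2 - (ℒ i).c)} ∧
    ∃ p : F × F, ∀ i, 0 < ε i * ((ℒ i).a * p.1 + (ℒ i).b * p.2 - (ℒ i).c)

/-- A region is bounded if it contains no half line. -/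
def IsBoundedRegion (R : Set (F × F)) : Prop :=
  ¬ ∃ v ∈ R, ∃ w ∈ R, v ≠ w ∧
    ((∀ t : F, 0 ≤ t → v + t • (w - v) ∈ R) ∨ (∀ t : F, t ≤ 0 → v + t • (w - v) ∈ R))

/-- The determinant of two vectors of the plane. -/
def det2 (v w : F × F) : F := v.1 * w.2 - v.2 * w.1

/-- The `n` lines form an `n`-gon `L₀ → L₁ → ⋯ → Lₙ₋₁ → L₀` in this anticlockwise cyclic order
(subscripts are read modulo `n`): there is a bounded region `R` which meets every line `L_{i+1}`
in the segment between the vertices `P_i = L_i ∩ L_{i+1}` and `P_{i+1} = L_{i+1} ∩ L_{i+2}`, no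
other line meets this segment between its end points, and `R` is on the left of the side `L_{i+1}`
traversed from `P_i` to `P_{i+1}`. -/
def IsAnticlockwiseGon {n : ℕ} [NeZero n] (ℒ : Fin n → PlaneLine F) : Prop :=
  ∃ R : Set (F × F), IsRegion ℒ R ∧ IsBoundedRegion R ∧
    ∃ P : Fin n → F × F,
      (∀ i, P i ∈ (ℒ i).points ∩ (ℒ (i + 1)).points) ∧
      (∀ i, (ℒ (i + 1)).points ∩ R = segment F (P i) (P (i + 1))) ∧
      (∀ i, ∀ p ∈ openSegment F (P i) (P (i + 1)), ∀ j, p ∈ (ℒ j).points → j = i + 1) ∧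
      (∀ i, ∀ p ∈ R, 0 ≤ det2 (P (i + 1) - P i) (p - P i))

/-! ### Slope order and rotations -/

/-- The slope order `0 → ∞ → -∞ → 0`: the order of the angles in `[0, π)`. The slopes
`≥ 0` (including `∞`) come first, then the negative ones, each group in increasing order. -/
def SlopeLT (m m' : WithTop F) : Prop :=
  (0 ≤ m ∧ m' < 0) ∨ ((0 ≤ m ↔ 0 ≤ m') ∧ m < m')

/-- The image of a line under `(x, y) ↦ (u x - v y, v x + u y)` where `(u, v) ≠ 0`, a rotation
about the origin followed by a dilation. The dilation, which does not change slopes, is there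
because the sine and the cosine of the angle of rotation need not belong to `F`. -/
def PlaneLine.rotate (u v : F) (h : u ≠ 0 ∨ v ≠ 0) (L : PlaneLine F) : PlaneLine F where
  a := u * L.a - v * L.b
  b := v * L.a + u * L.b
  c := (u ^ 2 + v ^ 2) * L.c
  ne_zero := by
    by_contra hne
    push Not at hne
    obtain ⟨h1, h2⟩ := hne
    have key : (u ^ 2 + v ^ 2) * (L.a ^ 2 + L.b ^ 2) = 0 := by
      linear_combination (u * L.a - v * L.b) * h1 + (v * L.a + u * L.b) * h2
    have pos : ∀ x y : F, (x ≠ 0 ∨ y ≠ 0) → 0 < x ^ 2 + y ^ 2 := by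
      rintro x y (hx | hy) <;> positivity
    exact (mul_pos (pos u v h) (pos L.a L.b L.ne_zero)).ne' key

/-- The slopes `m₀, …, mₙ₋₁` increase from `m₀` to `mⱼ₋₁` and again from `mⱼ` to `mₙ₋₁`
in the slope order, and `m₀` is non-negative with `m₀ ≺ mⱼ ≺ mⱼ₋₁`. Hence `m₀` is the least
of the slopes, and `j` is the only place at which the sequence descends. Each of the two
increasing sequences consists of slopes in `[0, ∞]` followed by negative slopes. -/
structure HasSlopeStructure {n : ℕ} [NeZero n] (m : Fin n → WithTop F) (j : Fin n) : Prop where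
  pos : 0 < j
  nonneg : 0 ≤ m 0
  first : ∀ x y, x < y → y < j → SlopeLT (m x) (m y)
  second : ∀ x y, j ≤ x → x < y → SlopeLT (m x) (m y)
  least : SlopeLT (m 0) (m j)
  descent : SlopeLT (m j) (m (j - 1))

/-- The 2-standard consecutive structure `0 < 1 < ⋯ < j - 1`, `j < j + 1 < ⋯ < n - 1` respects
the slope property: modulo a rotation of the plane, the slopes of the lines are
arranged accordingly. -/
def RespectsSlopeProperty {n : ℕ} [NeZero n] (ℒ : Fin n → PlaneLine F) (j : Fin n) : Prop :=
  ∃ (u v : F) (h : u ≠ 0 ∨ v ≠ 0), HasSlopeStructure (fun i => ((ℒ i).rotate u v h).slope) j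

/-- The vertex `L_j ∩ L_{j+1}` is the opposite vertex of the side `L_k` of the polygon
`L₀ → L₁ → ⋯ → Lₙ₋₁ → L₀`: after a rotation of the plane for which `L_k` has the least non-negative
slope, the slopes of `L_k, L_{k+1}, …, L_j` increase in the slope order, and so do those of
`L_{j+1}, …, L_{k-1}`, with a descent from `L_j` to `L_{j+1}` (subscripts modulo `n`). -/
def IsOppositeVertex {n : ℕ} [NeZero n] (ℒ : Fin n → PlaneLine F) (k j : Fin n) : Prop :=
  ∃ (u v : F) (h : u ≠ 0 ∨ v ≠ 0),
    HasSlopeStructure (fun i => ((ℒ (k + i)).rotate u v h).slope) (j + 1 - k)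

/-! ### The cycle at infinity -/

/-- `σ` is the cycle at infinity of the arrangement. The line `M : a x + b y = c > 0` is parallel
to no line of the arrangement and has all intersection vertices strictly on the side of
the origin; `M` is oriented with the origin on its left, that is, in the direction `(-b, a)`; and
`σ` is the cycle `(e 0, e 1, …, e (n - 1))` of the subscripts of the lines in the order in which
they meet `M`. -/
def IsCycleAtInfinity {n : ℕ} [NeZero n] (ℒ : Fin n → PlaneLine F)
    (σ : Equiv.Perm (Fin n)) : Prop :=
  ∃ M : PlaneLine F, 0 < M.c ∧ (∀ i, ¬ M.Parallel (ℒ i)) ∧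
    (∀ i j, i ≠ j → ∀ p ∈ (ℒ i).points ∩ (ℒ j).points, M.a * p.1 + M.b * p.2 < M.c) ∧
    ∃ e : Equiv.Perm (Fin n),
      (∀ s t, s < t → ∀ p ∈ M.points ∩ (ℒ (e s)).points, ∀ q ∈ M.points ∩ (ℒ (e t)).points,
        -M.b * p.1 + M.a * p.2 < -M.b * q.1 + M.a * q.2) ∧
      ∀ t, σ (e t) = e (t + 1)

/-- The `n`-cycle `σ`, written as `(e 0, …, e (n - 1))` with `e 0 = 0` the first letter, has the
2-standard consecutive structure `0 < 1 < ⋯ < j - 1`, `j < j + 1 < ⋯ < n - 1`: the letters of each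
of the two runs occur from left to right in this order, and a single run does not
suffice (`e.symm x` is the place at which the letter `x` occurs). -/
def IsTwoStandardAt {n : ℕ} [NeZero n] (σ : Equiv.Perm (Fin n)) (j : Fin n) : Prop :=
  ∃ e : Equiv.Perm (Fin n), e 0 = 0 ∧ (∀ t, σ (e t) = e (t + 1)) ∧ 0 < j ∧
    (∀ x y, x < y → y < j → e.symm x < e.symm y) ∧
    (∀ x y, j ≤ x → x < y → e.symm x < e.symm y) ∧
    ¬ ∀ x y, x < y → e.symm x < e.symm y

/-- The conjugate of `σ` by the cyclic renumbering that gives the letter `k` the number `0`. -/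
def renumber {n : ℕ} [NeZero n] (k : Fin n) (σ : Equiv.Perm (Fin n)) : Equiv.Perm (Fin n) :=
  (Equiv.addLeft k).trans (σ.trans (Equiv.addLeft k).symm)

/-! ### Isomorphism of arrangements -/

/-- A closed convex polyhedral set: a finite intersection of closed half planes. -/
def IsPolyhedral (S : Set (F × F)) : Prop :=
  ∃ H : Finset (F × F × F), S = {p | ∀ h ∈ H, h.1 * p.1 + h.2.1 * p.2 ≤ h.2.2}

/-- A bijection of the plane is piecewise linear if the plane is a finite union of closed
polyhedral sets on each of which the map is affine. (Continuity, and the same property for the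
inverse, are consequences.) -/
def IsPiecewiseLinear (f : F × F ≃ F × F) : Prop :=
  ∃ C : Set (Set (F × F)), C.Finite ∧ ⋃₀ C = Set.univ ∧
    ∀ S ∈ C, IsPolyhedral S ∧ ∃ A : F × F →ᵃ[F] F × F, Set.EqOn f A S

/-- Two arrangements are isomorphic if a piecewise linear automorphism of the plane takes the lines
of the first one to the lines of the second one. -/
def Isomorphic {n : ℕ} (ℒ ℒ' : Fin n → PlaneLine F) : Prop :=
  ∃ f : F × F ≃ F × F, IsPiecewiseLinear f ∧
    Set.range (fun i => f '' (ℒ i).points) = Set.range (fun i => (ℒ' i).points)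

end LineArr

/-!
Let `A 0, …, A (n - 1)` be the vertices of the polygon and `side A i` the vector from `A i` to
`A (i + 1)`, which is a direction of the `i`-th line. Everything in the theorem is read off from the
signs of the determinants `det2 (side A i) (side A j)`.

*The switch.* The polygon lies in the angle at each of its vertices, so the height of the vertices
above the side `k` has no local minimum away from that side. Hence the determinants of `k` with
`k + 1, k + 2, …` are positive up to some place `s` and negative from there on
(`IsVertexCycle.exists_isSwitch`). Since consecutive sides turn left, the directions modulo half a
turn increase from `k` to `k + s - 1` and from `k + s` to `k - 1`, and descend from `k + s - 1` to
`k + s` (`IsSwitch.before`, `IsSwitch.before_sub_one`).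

*Slopes and infinity.* In the slope order after a rotation, and along a line far away, the lines
are ordered by the signs of the determinants of their directions, oriented towards a common half
plane (`exists_signs_slopeLT`, `IsCycleAtInfinity.exists_signs`). Both orders agree, from the letter
`k` on, with the order `Before A k`. So the opposite vertex of the side `k` and the 2-standard
consecutive structure of the renumbered cycle at infinity are both located by the only descent,
which is at the switch (`IsSwitch.isOppositeVertex_iff`, `IsSwitch.isTwoStandardAt_iff`).
Conversely, the switches determine the signs of all the determinants, and these the cycle.

*Isomorphism.* By Cramer's rule, evaluated at a point in the middle of a side, the orientation of
the triangle formed by three sides is the majority of the signs of their three pairwise determinants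
(`IsVertexCycle.sign_det3`). So two polygons with the same switches have homogeneous forms,
the line at infinity included, whose triple determinants have the same signs. Then the same sign
vectors occur for both families of forms, because every vector is a sum of vectors in its closed
cell at which two independent forms vanish (`exists_sign_form_eq`). A sign-preserving
piecewise linear bijection of three-space is obtained by choosing corresponding points `v X`, `v' X`
in the open cells `X` and sending `r • v X + y`, with `y` on the boundary of the cell, to
`r • v' X` plus the image of `y` (`CellMap`, `exists_conewise_linear_equiv`). It preserves the last
coordinate if the chosen points have equal last coordinates, and so restricts to the affine
plane (`exists_piecewiseLinear_equiv`).
-/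

set_option linter.unusedSectionVars false

namespace LineArr

section SignVectors

variable {F : Type*} [Field F] [LinearOrder F] [IsStrictOrderedRing F]

/-! ### Signs -/

theorem sign_mul_add {r b y : F} (hr : 0 < r)
    (h : SignType.sign y = 0 ∨ SignType.sign y = SignType.sign b) :
    SignType.sign (r * b + y) = SignType.sign b := by
  rcases lt_trichotomy b 0 with hb | rfl | hb
  · have hy : y ≤ 0 := by
      rcases h with h | h
      · exact (sign_eq_zero_iff.1 h).le
      · rw [sign_neg hb, sign_eq_neg_one_iff] at h; exact h.le
    rw [sign_neg hb, sign_neg]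
    nlinarith [mul_neg_of_pos_of_neg hr hb]
  · simpa using h
  · have hy : 0 ≤ y := by
      rcases h with h | h
      · exact (sign_eq_zero_iff.1 h).ge
      · rw [sign_pos hb, sign_eq_one_iff] at h; exact h.le
    rw [sign_pos hb, sign_pos]
    nlinarith [mul_pos hr hb]

theorem sign_mul_left_of_nonneg {b c : F} (hc : 0 ≤ c) :
    SignType.sign (c * b) = 0 ∨ SignType.sign (c * b) = SignType.sign b := by
  rcases hc.eq_or_lt with rfl | hc
  · simp
  · right; simp [sign_mul, sign_pos hc]

variable {ι V : Type*} [AddCommGroup V] [Module F V]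

/-- The vector `x` lies in the closed cell with sign vector `X`: every form either vanishes at `x`
or has there the sign prescribed by `X`. -/
def Conforms (f : ι → V →ₗ[F] F) (X : ι → SignType) (x : V) : Prop :=
  ∀ i, SignType.sign (f i x) = 0 ∨ SignType.sign (f i x) = X i

/-- The graph of the piecewise linear map between two arrangements of hyperplanes through the
origin, where `v X` and `v' X` are chosen in the open cells with sign vector `X`. A point
of the open cell `X` is `r • v X + y` with `r > 0` and `y` on the boundary of the cell, and it
goes to `r • v' X + y'`, where `y'` is the image of `y`. -/
inductive CellMap (f f' : ι → V →ₗ[F] F) (v v' : (ι → SignType) → V) : V → V → Prop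
  | zero : CellMap f f' v v' 0 0
  | step {y y' : V} (X : ι → SignType) (r : F) (hr : 0 < r)
      (hv : ∀ i, SignType.sign (f i (v X)) = X i) (hv' : ∀ i, SignType.sign (f' i (v' X)) = X i)
      (hy : Conforms f X y) (hi : ∃ i, X i ≠ 0 ∧ f i y = 0) (h : CellMap f f' v v' y y') :
      CellMap f f' v v' (r • v X + y) (r • v' X + y')

namespace CellMap

variable {f f' : ι → V →ₗ[F] F} {v v' : (ι → SignType) → V}

theorem sign_eq {x x' : V} (h : CellMap f f' v v' x x') (i : ι) :
    SignType.sign (f i x) = SignType.sign (f' i x') := by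
  induction h with
  | zero => simp
  | step X r hr hv hv' hy hi h ih =>
    simp only [map_add, map_smul, smul_eq_mul]
    rw [sign_mul_add hr (by rw [hv]; exact hy i),
      sign_mul_add hr (by rw [hv', ← ih]; exact hy i), hv, hv']

theorem symm {x x' : V} (h : CellMap f f' v v' x x') : CellMap f' f v' v x' x := by
  induction h with
  | zero => exact zero
  | step X r hr hv hv' hy hi h ih =>
    refine step X r hr hv' hv (fun i => ?_) ?_ ih
    · rw [← h.sign_eq]; exact hy i
    · obtain ⟨i, hX, h0⟩ := hi
      refine ⟨i, hX, ?_⟩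
      rw [← sign_eq_zero_iff, ← h.sign_eq, h0, sign_zero]

theorem map_eq {x x' : V} (t : V →ₗ[F] F) (ht : ∀ X, t (v X) = t (v' X))
    (h : CellMap f f' v v' x x') : t x = t x' := by
  induction h with
  | zero => rfl
  | step X r hr hv hv' hy hi h ih => simp [ht, ih]

theorem eq_or_exists {x x' : V} (h : CellMap f f' v v' x x') :
    (x = 0 ∧ x' = 0) ∨ ∃ (y y' : V) (r : F), 0 < r ∧
      x = r • v (fun i => SignType.sign (f i x)) + y ∧
      x' = r • v' (fun i => SignType.sign (f i x)) + y' ∧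
      (∀ i, SignType.sign (f i (v fun i => SignType.sign (f i x))) = SignType.sign (f i x)) ∧
      Conforms f (fun i => SignType.sign (f i x)) y ∧
      (∃ i, SignType.sign (f i x) ≠ 0 ∧ f i y = 0) ∧ CellMap f f' v v' y y' := by
  cases h with
  | zero => exact .inl ⟨rfl, rfl⟩
  | @step y y' X r hr hv hv' hy hi h =>
    have hX : (fun i => SignType.sign (f i (r • v X + y))) = X := by
      funext i
      simp only [map_add, map_smul, smul_eq_mul]
      rw [sign_mul_add hr (by rw [hv]; exact hy i), hv]
    right
    refine ⟨y, y', r, hr, ?_⟩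
    have hX' := fun i => congrFun hX i
    simp only [hX']
    exact ⟨trivial, trivial, hv, hy, hi, h⟩

/-- The coefficient `r` in `x = r • w + y` is the largest one that leaves `y` in the cell of `w`. -/
theorem coeff_le {w y y₂ : V} {r r₂ : F} {i : ι} (hw : f i w ≠ 0) (h : r • w + y = r₂ • w + y₂)
    (hy : f i y = 0)
    (hy₂ : SignType.sign (f i y₂) = 0 ∨ SignType.sign (f i y₂) = SignType.sign (f i w)) :
    r₂ ≤ r := by
  by_contra! hlt
  have h1 := congrArg (f i) h
  simp only [map_add, map_smul, smul_eq_mul, hy, add_zero] at h1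
  have h2 := sign_mul_add (sub_pos.2 hlt) hy₂
  rw [show (r₂ - r) * f i w + f i y₂ = 0 by linear_combination -h1, sign_zero] at h2
  exact hw (sign_eq_zero_iff.1 h2.symm)

theorem unique {x x₁ x₂ : V} (h₁ : CellMap f f' v v' x x₁) (h₂ : CellMap f f' v v' x x₂) :
    x₁ = x₂ := by
  induction h₁ generalizing x₂ with
  | zero =>
    rcases h₂.eq_or_exists with h | ⟨y, y', r, -, -, -, -, -, ⟨i, hi, -⟩, -⟩
    · exact h.2.symm
    · simp at hi
  | @step y y' X r hr hv hv' hy hi h ih =>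
    have hX : (fun i => SignType.sign (f i (r • v X + y))) = X := by
      funext i
      simp only [map_add, map_smul, smul_eq_mul]
      rw [sign_mul_add hr (by rw [hv]; exact hy i), hv]
    have hX' := fun i => congrFun hX i
    rcases h₂.eq_or_exists with h0 | ⟨y₂, y₂', r₂, hr₂, hx, hx', -, hy₂, hi₂, h₂⟩
    · obtain ⟨i, hi, -⟩ := hi
      refine absurd (hX' i) ?_
      rw [h0.1, map_zero, sign_zero]
      exact hi.symm
    · simp only [hX'] at hx hx' hy₂ hi₂
      have hrr : r = r₂ := by
        obtain ⟨i, hi, hi0⟩ := hi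
        obtain ⟨j, hj, hj0⟩ := hi₂
        apply le_antisymm
        · refine coeff_le (f := f) (i := j) ?_ hx.symm hj0 ?_
          · rw [← sign_ne_zero, hv]; exact hj
          · rw [hv]; exact hy j
        · refine coeff_le (f := f) (i := i) ?_ hx hi0 ?_
          · rw [← sign_ne_zero, hv]; exact hi
          · rw [hv]; exact hy₂ i
      subst hrr
      obtain rfl := add_left_cancel hx
      rw [hx', ih h₂]

end CellMap

/-! ### Polyhedral cones and piecewise linearity -/

/-- A polyhedral cone: a finite intersection of closed half spaces with the origin on the
boundary. -/
def IsPolyCone (S : Set V) : Prop :=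
  ∃ H : Set (V →ₗ[F] F), H.Finite ∧ S = {x | ∀ h ∈ H, h x ≤ 0}

theorem isPolyCone_le (g : V →ₗ[F] F) : IsPolyCone (F := F) {x | g x ≤ 0} :=
  ⟨{g}, Set.finite_singleton g, by simp⟩

theorem IsPolyCone.inter {S T : Set V} (hS : IsPolyCone (F := F) S)
    (hT : IsPolyCone (F := F) T) : IsPolyCone (F := F) (S ∩ T) := by
  obtain ⟨H, hH, rfl⟩ := hS
  obtain ⟨K, hK, rfl⟩ := hT
  refine ⟨H ∪ K, hH.union hK, ?_⟩
  ext x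
  simp [or_imp, forall_and]

theorem IsPolyCone.iInter {κ : Type*} [Finite κ] {S : κ → Set V}
    (hS : ∀ k, IsPolyCone (F := F) (S k)) : IsPolyCone (F := F) (⋂ k, S k) := by
  choose H hH hS using hS
  refine ⟨⋃ k, H k, Set.finite_iUnion hH, ?_⟩
  ext x
  simp only [hS, Set.mem_iInter, Set.mem_ofPred_eq, Set.mem_iUnion]
  exact ⟨fun h g ⟨k, hk⟩ => h k g hk, fun h k g hk => h g ⟨k, hk⟩⟩

theorem IsPolyCone.preimage {S : Set V} (hS : IsPolyCone (F := F) S) (g : V →ₗ[F] V) :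
    IsPolyCone (F := F) (g ⁻¹' S) := by
  obtain ⟨H, hH, rfl⟩ := hS
  refine ⟨(fun h => h.comp g) '' H, hH.image _, ?_⟩
  ext x
  simp

theorem isPolyCone_conforms [Finite ι] (f : ι → V →ₗ[F] F) (X : ι → SignType) :
    IsPolyCone (F := F) {x | Conforms f X x} := by
  have : {x | Conforms f X x} =
      ⋂ i, {x | SignType.sign (f i x) = 0 ∨ SignType.sign (f i x) = X i} := by
    ext x; simp [Conforms]
  rw [this]
  refine IsPolyCone.iInter fun i => ?_
  have key : {x | SignType.sign (f i x) = 0 ∨ SignType.sign (f i x) = 1} =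
      {x | (-f i) x ≤ 0} := by
    ext x
    simp [sign_eq_zero_iff, sign_eq_one_iff, le_iff_eq_or_lt]
  have key' : {x | SignType.sign (f i x) = 0 ∨ SignType.sign (f i x) = -1} =
      {x | f i x ≤ 0} := by
    ext x
    simp [sign_eq_zero_iff, sign_eq_neg_one_iff, le_iff_eq_or_lt]
  rcases h : X i with _ | _ | _
  · have : {x | SignType.sign (f i x) = 0 ∨ SignType.sign (f i x) = SignType.zero} =
        {x | (-f i) x ≤ 0} ∩ {x | f i x ≤ 0} := by
      rw [← key, ← key']
      ext x
      simp only [Set.mem_ofPred_eq, Set.mem_inter_iff]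
      rcases SignType.sign (f i x) <;> decide
    rw [this]
    exact (isPolyCone_le _).inter (isPolyCone_le _)
  · exact key' ▸ isPolyCone_le _
  · exact key ▸ isPolyCone_le _

/-- The relation `P` contains, over all of `S`, the graph of a map that is linear on each of
finitely many polyhedral cones. -/
def IsConewiseLinearOn (P : V → V → Prop) (S : Set V) : Prop :=
  ∃ C : Set (Set V × (V →ₗ[F] V)), C.Finite ∧
    (∀ q ∈ C, IsPolyCone (F := F) q.1 ∧ ∀ x ∈ q.1, P x (q.2 x)) ∧ ∀ x ∈ S, ∃ q ∈ C, x ∈ q.1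

theorem IsConewiseLinearOn.iUnion {κ : Type*} [Finite κ] {P : V → V → Prop} {S : κ → Set V}
    (h : ∀ k, IsConewiseLinearOn (F := F) P (S k)) :
    IsConewiseLinearOn (F := F) P (⋃ k, S k) := by
  choose C hC hP hS using h
  refine ⟨⋃ k, C k, Set.finite_iUnion hC, ?_, ?_⟩
  · rintro q hq
    obtain ⟨k, hk⟩ := Set.mem_iUnion.1 hq
    exact hP k q hk
  · rintro x hx
    obtain ⟨k, hk⟩ := Set.mem_iUnion.1 hx
    obtain ⟨q, hq, hxq⟩ := hS k x hk
    exact ⟨q, Set.mem_iUnion.2 ⟨k, hq⟩, hxq⟩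

theorem IsConewiseLinearOn.mono {P : V → V → Prop} {S T : Set V}
    (h : IsConewiseLinearOn (F := F) P T) (hST : S ⊆ T) : IsConewiseLinearOn (F := F) P S := by
  obtain ⟨C, hC, hP, hT⟩ := h
  exact ⟨C, hC, hP, fun x hx => hT x (hST hx)⟩

/-- The set considered here consists of the points of the closed cell `X` that are carried into `S`
by moving in the direction `-v X` up to the first zero of a form, which is one of the form `i`. -/
theorem CellMap.isConewiseLinearOn_step [Finite ι] {f f' : ι → V →ₗ[F] F}
    {v v' : (ι → SignType) → V} {X : ι → SignType} (i : ι) (hX : X i ≠ 0)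
    (hv : ∀ i, SignType.sign (f i (v X)) = X i) (hv' : ∀ i, SignType.sign (f' i (v' X)) = X i)
    {S : Set V} (hS : IsConewiseLinearOn (F := F) (CellMap f f' v v') S) :
    IsConewiseLinearOn (F := F) (CellMap f f' v v')
      {x | Conforms f X x ∧ (∀ k, X k ≠ 0 → f i x / f i (v X) ≤ f k x / f k (v X)) ∧
        x - (f i x / f i (v X)) • v X ∈ S} := by
  obtain ⟨C, hC, hP, hCS⟩ := hS
  let ℓ : V →ₗ[F] F := (f i (v X))⁻¹ • f i
  have hℓ : ∀ x, ℓ x = f i x / f i (v X) := fun x => by simp [ℓ, div_eq_inv_mul]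
  let g : V →ₗ[F] V := LinearMap.id - ℓ.smulRight (v X)
  have hg : ∀ x, g x = x - (f i x / f i (v X)) • v X := fun x => by simp [g, hℓ]
  refine ⟨(fun q => ({x | Conforms f X x} ∩
    ((⋂ k : {k // X k ≠ 0}, {x | (ℓ - (f k (v X))⁻¹ • f k) x ≤ 0}) ∩ g ⁻¹' q.1),
    ℓ.smulRight (v' X) + q.2.comp g)) '' C, hC.image _, ?_, ?_⟩
  · rintro _ ⟨q, hq, rfl⟩
    obtain ⟨hq1, hq2⟩ := hP q hq
    refine ⟨(isPolyCone_conforms f X).inter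
      ((IsPolyCone.iInter fun k => isPolyCone_le _).inter (hq1.preimage g)), ?_⟩
    rintro x ⟨hx, hmin, hxq⟩
    have hfi : f i (v X) ≠ 0 := by rw [← sign_ne_zero, hv]; exact hX
    have h := hq2 _ hxq
    have hr : 0 ≤ ℓ x := by
      have h1 : SignType.sign (f i x) = 0 ∨ SignType.sign (f i x) = SignType.sign (f i (v X)) := by
        rw [hv]; exact hx i
      rw [hℓ]
      rcases h1 with h1 | h1
      · rw [sign_eq_zero_iff.1 h1, zero_div]
      · rcases lt_or_gt_of_ne hfi with h2 | h2
        · rw [sign_neg h2, sign_eq_neg_one_iff] at h1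
          exact (div_pos_of_neg_of_neg h1 h2).le
        · rw [sign_pos h2, sign_eq_one_iff] at h1
          exact (div_pos h1 h2).le
    have hgx : g x = x - ℓ x • v X := by rw [hg, hℓ]
    rcases hr.eq_or_lt with h0 | hr
    · -- A point of the boundary: nothing is subtracted.
      have : g x = x := by rw [hgx, ← h0]; simp
      simp only [LinearMap.add_apply, LinearMap.smulRight_apply, LinearMap.comp_apply, ← h0,
        zero_smul, zero_add]
      rw [this] at h ⊢
      exact h
    · have hx' : x = ℓ x • v X + g x := by rw [hgx]; abel
      have hgk : ∀ k, f k (g x) = f k x - ℓ x * f k (v X) := fun k => by simp [hgx]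
      have := CellMap.step X (ℓ x) hr hv hv' ?_ ⟨i, hX, ?_⟩ h
      · rwa [← hx'] at this
      · intro k
        by_cases hk : X k = 0
        · left
          have h1 : f k (v X) = 0 := by rw [← sign_eq_zero_iff, hv, hk]
          have h2 := hx k
          rw [hk, or_self] at h2
          rw [hgk, h1, mul_zero, sub_zero, h2]
        · have h1 : f k (v X) ≠ 0 := by rw [← sign_ne_zero, hv]; exact hk
          have h2 := Set.mem_iInter.1 hmin ⟨k, hk⟩
          simp only [Set.mem_ofPred_eq, LinearMap.sub_apply, LinearMap.smul_apply,
            smul_eq_mul] at h2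
          have h3 : f k (g x) = ((f k (v X))⁻¹ * f k x - ℓ x) * f k (v X) := by
            rw [hgk]; field_simp
          rw [h3, ← hv k]
          exact sign_mul_left_of_nonneg (by linarith)
      · rw [hgk, hℓ, div_mul_cancel₀ _ hfi, sub_self]
  · rintro x ⟨hx, hmin, hxS⟩
    obtain ⟨q, hq, hxq⟩ := hCS _ hxS
    refine ⟨_, ⟨q, hq, rfl⟩, hx, ?_, ?_⟩
    · refine Set.mem_iInter.2 fun k => ?_
      have := hmin k k.2
      simp only [Set.mem_ofPred_eq, LinearMap.sub_apply, hℓ, LinearMap.smul_apply, smul_eq_mul,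
        ← div_eq_inv_mul]
      linarith
    · simpa [hg] using hxq

/-- On every closed cell the map is linear on finitely many polyhedral cones, by induction on the
number of forms that do not vanish on the cell. -/
theorem CellMap.isConewiseLinearOn_cell [Fintype ι] {f f' : ι → V →ₗ[F] F}
    {v v' : (ι → SignType) → V} (hf : ∀ x, (∀ i, f i x = 0) → x = 0)
    (hv : ∀ x i, SignType.sign (f i (v fun i => SignType.sign (f i x))) = SignType.sign (f i x))
    (hv' : ∀ x i, SignType.sign (f' i (v' fun i => SignType.sign (f i x))) = SignType.sign (f i x))
    (m : ℕ) (z : V) (hz : (Finset.univ.filter fun i => f i z ≠ 0).card ≤ m) :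
    IsConewiseLinearOn (F := F) (CellMap f f' v v')
      {x | Conforms f (fun i => SignType.sign (f i z)) x} := by
  classical
  induction m generalizing z with
  | zero =>
    have hz0 : ∀ i, f i z = 0 := by simpa [Finset.filter_eq_empty_iff] using hz
    have hX : ∀ x, Conforms f (fun i => SignType.sign (f i z)) x → x = 0 := fun x hx =>
      hf x fun i => by simpa [hz0] using hx i
    refine ⟨{({x | Conforms f (fun i => SignType.sign (f i z)) x}, 0)}, Set.finite_singleton _,
      ?_, fun x hx => ⟨_, rfl, hx⟩⟩
    rintro q rfl
    refine ⟨isPolyCone_conforms _ _, fun x hx => ?_⟩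
    rw [hX x hx]
    exact CellMap.zero
  | succ m ih =>
    by_cases hz0 : ∀ i, f i z = 0
    · exact ih z (by simp [hz0])
    push Not at hz0
    set X : ι → SignType := fun i => SignType.sign (f i z) with hXdef
    -- The pieces are indexed by the form `i` that vanishes first and the sign vector of the rest.
    have hall : ∀ (i : {i // X i ≠ 0}) (Y : {Y : ι → SignType // ∃ y,
        (Finset.univ.filter fun i => f i y ≠ 0).card ≤ m ∧ Y = fun i => SignType.sign (f i y)}),
        IsConewiseLinearOn (F := F) (CellMap f f' v v')
          {x | Conforms f X x ∧ (∀ k, X k ≠ 0 → f i x / f i (v X) ≤ f k x / f k (v X)) ∧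
            x - (f i x / f i (v X)) • v X ∈ {x | Conforms f Y.1 x}} := by
      rintro i ⟨Y, y, hy, rfl⟩
      exact CellMap.isConewiseLinearOn_step _ i.2 (hv z) (hv' z) (ih y hy)
    refine (IsConewiseLinearOn.iUnion fun i => IsConewiseLinearOn.iUnion (hall i)).mono ?_
    intro x hx
    obtain ⟨i, hi, hmin⟩ := Finset.exists_min_image (Finset.univ.filter fun i => X i ≠ 0)
      (fun i => f i x / f i (v X)) (by
        obtain ⟨i, hi⟩ := hz0
        exact ⟨i, by simpa [X] using hi⟩)
    have hXi : X i ≠ 0 := (Finset.mem_filter.1 hi).2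
    have hfi : f i (v X) ≠ 0 := by rw [← sign_ne_zero, hv z]; exact hXi
    have hfk : ∀ k, f k (x - (f i x / f i (v X)) • v X) =
      f k x - f i x / f i (v X) * f k (v X) := fun k => by simp
    refine Set.mem_iUnion.2 ⟨⟨i, hXi⟩, Set.mem_iUnion.2
      ⟨⟨_, x - (f i x / f i (v X)) • v X, ?_, rfl⟩, hx, fun k hk => hmin k (by simpa using hk),
        fun k => Or.inr rfl⟩⟩
    refine Nat.le_of_lt_succ (lt_of_lt_of_le (Finset.card_lt_card ?_) hz)
    rw [Finset.ssubset_iff_of_subset]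
    · refine ⟨i, by simpa [X] using hXi, ?_⟩
      simp [div_mul_cancel₀ _ hfi]
    · intro k
      simp only [Finset.mem_filter, Finset.mem_univ, true_and]
      contrapose!
      intro hk
      have hXk : X k = 0 := by simp [X, hk]
      have h1 : f k (v X) = 0 := by rw [← sign_eq_zero_iff, hv z, hk, sign_zero]
      have h2 := hx k
      rw [hXk, or_self, sign_eq_zero_iff] at h2
      rw [hfk, h1, h2, mul_zero, sub_zero]

/-- Two essential families of linear forms with the same sign vectors are related by a
conewise linear bijection that preserves the signs; if the chosen points of the open cells have
the same value under a form `t`, then the bijection preserves `t`. -/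
theorem exists_conewise_linear_equiv [Fintype ι] {f f' : ι → V →ₗ[F] F} (t : V →ₗ[F] F)
    {v v' : (ι → SignType) → V} (hf : ∀ x, (∀ i, f i x = 0) → x = 0)
    (hf' : ∀ x, (∀ i, f' i x = 0) → x = 0)
    (hv : ∀ x i, SignType.sign (f i (v fun i => SignType.sign (f i x))) = SignType.sign (f i x))
    (hv' : ∀ x i, SignType.sign (f' i (v' fun i => SignType.sign (f i x))) = SignType.sign (f i x))
    (hu : ∀ x i, SignType.sign (f i (v fun i => SignType.sign (f' i x))) = SignType.sign (f' i x))
    (hu' : ∀ x i,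
      SignType.sign (f' i (v' fun i => SignType.sign (f' i x))) = SignType.sign (f' i x))
    (ht : ∀ X, t (v X) = t (v' X)) :
    ∃ φ : V ≃ V, (∀ x i, SignType.sign (f' i (φ x)) = SignType.sign (f i x)) ∧
      (∀ x, t (φ x) = t x) ∧
      IsConewiseLinearOn (F := F) (fun x y => φ x = y) Set.univ := by
  have key := CellMap.isConewiseLinearOn_cell hf hv hv' (Fintype.card ι)
  have key' := CellMap.isConewiseLinearOn_cell hf' hu' hu (Fintype.card ι)
  have total : ∀ x, ∃ y, CellMap f f' v v' x y := fun x => by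
    obtain ⟨C, -, hC, hx⟩ := key x (Finset.card_le_univ _)
    obtain ⟨q, hq, hxq⟩ := hx x fun i => Or.inr rfl
    exact ⟨_, (hC q hq).2 x hxq⟩
  have total' : ∀ x, ∃ y, CellMap f' f v' v x y := fun x => by
    obtain ⟨C, -, hC, hx⟩ := key' x (Finset.card_le_univ _)
    obtain ⟨q, hq, hxq⟩ := hx x fun i => Or.inr rfl
    exact ⟨_, (hC q hq).2 x hxq⟩
  choose φ hφ using total
  choose ψ hψ using total'
  refine ⟨⟨φ, ψ, fun x => (hψ _).unique (hφ x).symm, fun x => (hφ _).unique (hψ x).symm⟩,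
    fun x i => ((hφ x).sign_eq i).symm, fun x => ((hφ x).map_eq t ht).symm, ?_⟩
  have hcell : ∀ X : {X : ι → SignType // ∃ x, X = fun i => SignType.sign (f i x)},
      IsConewiseLinearOn (F := F) (CellMap f f' v v') {x | Conforms f X.1 x} := by
    rintro ⟨X, x, rfl⟩
    exact key x (Finset.card_le_univ _)
  obtain ⟨C, hC, hP, hS⟩ := IsConewiseLinearOn.iUnion hcell
  refine ⟨C, hC, fun q hq => ⟨(hP q hq).1, fun x hx => (hφ x).unique ((hP q hq).2 x hx)⟩,
    fun x _ => hS x (Set.mem_iUnion.2 ⟨⟨_, x, rfl⟩, fun i => Or.inr rfl⟩)⟩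

end SignVectors

section Covectors

variable {F : Type*} [Field F] [LinearOrder F] [IsStrictOrderedRing F]

/-! ### Sign vectors of a configuration in three-space -/

/-- The linear form `x ↦ g · x` on three-space. -/
def form (g : F × F × F) : F × F × F →ₗ[F] F where
  toFun x := g.1 * x.1 + g.2.1 * x.2.1 + g.2.2 * x.2.2
  map_add' x y := by simp only [Prod.fst_add, Prod.snd_add]; ring
  map_smul' r x := by
    simp only [Prod.smul_fst, Prod.smul_snd, smul_eq_mul, RingHom.id_apply]; ring

theorem form_apply (g x : F × F × F) :
    form g x = g.1 * x.1 + g.2.1 * x.2.1 + g.2.2 * x.2.2 := rfl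

/-- The cross product. -/
def cross3 (g h : F × F × F) : F × F × F :=
  (g.2.1 * h.2.2 - g.2.2 * h.2.1, g.2.2 * h.1 - g.1 * h.2.2, g.1 * h.2.1 - g.2.1 * h.1)

/-- The determinant of three vectors. -/
def det3 (g h k : F × F × F) : F := form k (cross3 g h)

theorem form_self_pos {x : F × F × F} (hx : x ≠ 0) : 0 < form x x := by
  obtain ⟨a, b, c⟩ := x
  simp only [form_apply]
  by_contra! h
  refine hx ?_
  have ha : a = 0 := by nlinarith [mul_self_nonneg a, mul_self_nonneg b, mul_self_nonneg c]
  have hb : b = 0 := by nlinarith [mul_self_nonneg a, mul_self_nonneg b, mul_self_nonneg c]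
  have hc : c = 0 := by nlinarith [mul_self_nonneg a, mul_self_nonneg b, mul_self_nonneg c]
  simp [ha, hb, hc]

theorem cross3_ne_zero {g x : F × F × F} (hg : g ≠ 0) (hx : x ≠ 0) (h : form g x = 0) :
    cross3 g x ≠ 0 := by
  intro h0
  have key : form (cross3 g x) (cross3 g x) = form g g * form x x - form g x ^ 2 := by
    simp only [form_apply, cross3]; ring
  rw [h0, h, map_zero] at key
  nlinarith [mul_pos (form_self_pos hg) (form_self_pos hx)]

theorem exists_ne_zero_form_eq_zero (x : F × F × F) : ∃ w : F × F × F, w ≠ 0 ∧ form w x = 0 := by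
  by_cases h : x.1 = 0
  · exact ⟨(1, 0, 0), by simp, by simp [form_apply, h]⟩
  · exact ⟨(-x.2.1, x.1, 0), by simp [h], by simp only [form_apply]; ring⟩

theorem eq_smul_cross3 {g h x : F × F × F} (hg : form g x = 0) (hh : form h x = 0)
    (hgh : cross3 g h ≠ 0) : ∃ μ : F, x = μ • cross3 g h := by
  have hpos := form_self_pos hgh
  refine ⟨form (cross3 g h) x / form (cross3 g h) (cross3 g h), ?_⟩
  simp only [form_apply] at hg hh
  rw [div_eq_inv_mul, mul_smul, eq_inv_smul_iff₀ hpos.ne']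
  obtain ⟨g1, g2, g3⟩ := g
  obtain ⟨h1, h2, h3⟩ := h
  obtain ⟨x1, x2, x3⟩ := x
  simp only [form_apply, cross3, Prod.smul_mk, smul_eq_mul, Prod.mk.injEq] at *
  refine ⟨?_, ?_, ?_⟩
  · linear_combination ((g1*h2 - g2*h1)*h2 - (g3*h1-g1*h3)*h3) * hg -
      ((g1*h2 - g2*h1)*g2 - (g3*h1-g1*h3)*g3) * hh
  · linear_combination ((g2*h3 - g3*h2)*h3 - (g1*h2-g2*h1)*h1) * hg -
      ((g2*h3 - g3*h2)*g3 - (g1*h2-g2*h1)*g1) * hh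
  · linear_combination ((g3*h1 - g1*h3)*h1 - (g2*h3-g3*h2)*h2) * hg -
      ((g3*h1 - g1*h3)*g1 - (g2*h3-g3*h2)*g2) * hh

variable {ι : Type*} [Fintype ι]

/-- Moving from `a` in the direction `b` up to the first place at which a coordinate
vanishes. -/
theorem exists_first_zero {a b : ι → F} (hab : ∀ i, a i = 0 → b i = 0)
    (hneg : ∃ i, a i * b i < 0) :
    ∃ r : F, 0 < r ∧
      (∀ i, SignType.sign (a i + r * b i) = 0 ∨
        SignType.sign (a i + r * b i) = SignType.sign (a i)) ∧
      ∃ i, a i ≠ 0 ∧ b i ≠ 0 ∧ a i + r * b i = 0 := by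
  classical
  obtain ⟨i, hi, hmin⟩ := Finset.exists_min_image (Finset.univ.filter fun i => a i * b i < 0)
    (fun i => -a i / b i) (by obtain ⟨i, hi⟩ := hneg; exact ⟨i, by simpa using hi⟩)
  simp only [Finset.mem_filter, Finset.mem_univ, true_and] at hi hmin
  have hbi : b i ≠ 0 := by rintro h; simp [h] at hi
  have hr : 0 < -a i / b i := by
    rw [div_eq_mul_inv, ← mul_pos_iff_of_pos_right (mul_self_pos.2 hbi)]
    field_simp
    linarith
  refine ⟨-a i / b i, hr, fun k => ?_, i, by rintro h; simp [h] at hi, hbi,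
    by field_simp; ring⟩
  by_cases hk : a k * b k < 0
  · have hbk : b k ≠ 0 := by rintro h; simp [h] at hk
    have hak : a k ≠ 0 := by rintro h; simp [h] at hk
    have h1 : a k + -a i / b i * b k = (1 - (-a i / b i) / (-a k / b k)) * a k := by
      field_simp
      ring
    rw [h1]
    refine sign_mul_left_of_nonneg (sub_nonneg.2 ((div_le_one ?_).2 (hmin k hk)))
    exact lt_of_lt_of_le hr (hmin k hk)
  · by_cases hak : a k = 0
    · left; simp [hak, hab k hak]
    · right
      push Not at hk
      rcases lt_or_gt_of_ne hak with h | h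
      · rw [sign_neg h, sign_neg]
        nlinarith [mul_nonneg hr.le (nonpos_of_mul_nonneg_right hk h |> neg_nonneg.2)]
      · rw [sign_pos h, sign_pos]
        nlinarith [mul_nonneg hr.le (nonneg_of_mul_nonneg_right hk h)]

theorem card_support_lt {a b : ι → F} (h : ∀ i, a i = 0 → b i = 0) (hi : ∃ i, a i ≠ 0 ∧ b i = 0) :
    (Finset.univ.filter fun i => b i ≠ 0).card < (Finset.univ.filter fun i => a i ≠ 0).card := by
  obtain ⟨i, hi⟩ := hi
  refine Finset.card_lt_card ((Finset.ssubset_iff_of_subset fun k => ?_).2 ⟨i, ?_, ?_⟩)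
  · simpa using mt (h k)
  · simpa using hi.1
  · simpa using hi.2

/-- Every closed cell other than the origin contains a vector that is orthogonal to two
independent forms. -/
theorem exists_conforming_cross3 {g : ι → F × F × F} (hg : ∀ x, (∀ i, form (g i) x = 0) → x = 0)
    (m : ℕ) (x : F × F × F) (hx : x ≠ 0)
    (hm : (Finset.univ.filter fun i => form (g i) x ≠ 0).card ≤ m) :
    ∃ (ε : F) (i j : ι), ε • cross3 (g i) (g j) ≠ 0 ∧
      Conforms (fun i => form (g i)) (fun i => SignType.sign (form (g i) x))
        (ε • cross3 (g i) (g j)) := by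
  classical
  induction m generalizing x with
  | zero =>
    exact absurd (hg x (by simpa [Finset.filter_eq_empty_iff] using hm)) hx
  | succ m ih =>
    by_cases hc : ∃ i j, form (g i) x = 0 ∧ form (g j) x = 0 ∧ cross3 (g i) (g j) ≠ 0
    · obtain ⟨i, j, hi, hj, hij⟩ := hc
      obtain ⟨μ, hμ⟩ := eq_smul_cross3 hi hj hij
      exact ⟨μ, i, j, hμ ▸ hx, fun k => Or.inr (by rw [← hμ])⟩
    · push Not at hc
      -- A direction `w`, not that of `x`, along which the forms that vanish at `x` stay zero.
      obtain ⟨w, hw0, hwx, hw⟩ : ∃ w : F × F × F, w ≠ 0 ∧ form w x = 0 ∧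
          ∀ i, form (g i) x = 0 → form (g i) w = 0 := by
        by_cases hz : ∃ i, form (g i) x = 0 ∧ g i ≠ 0
        · obtain ⟨i, hi, hgi⟩ := hz
          refine ⟨cross3 (g i) x, cross3_ne_zero hgi hx hi,
            by simp only [form_apply, cross3]; ring, fun k hk => ?_⟩
          have h1 : form (g k) (cross3 (g i) x) = form (cross3 (g k) (g i)) x := by
            simp only [form_apply, cross3]; ring
          rw [h1, hc k i hk hi]
          simp [form_apply]
        · push Not at hz
          obtain ⟨w, hw, hwx⟩ := exists_ne_zero_form_eq_zero x
          exact ⟨w, hw, hwx, fun i hi => by rw [hz i hi]; simp [form_apply]⟩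
      obtain ⟨k, hk⟩ : ∃ k, form (g k) w ≠ 0 := by
        by_contra! h
        exact hw0 (hg w h)
      obtain ⟨u, hux, hu, hneg⟩ : ∃ u : F × F × F, form u x = 0 ∧
          (∀ i, form (g i) x = 0 → form (g i) u = 0) ∧
          ∃ i, form (g i) x * form (g i) u < 0 := by
        have hkx : form (g k) x ≠ 0 := fun h => hk (hw k h)
        rcases lt_or_gt_of_ne (mul_ne_zero hkx hk) with h | h
        · exact ⟨w, hwx, hw, k, h⟩
        · refine ⟨-w, ?_, fun i hi => by rw [map_neg, hw i hi, neg_zero], k, ?_⟩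
          · rw [← neg_eq_zero, ← hwx]
            simp only [form_apply, Prod.fst_neg, Prod.snd_neg]; ring
          · rw [map_neg, mul_neg]; linarith
      obtain ⟨r, hr, hconf, i, hi, -, hi0⟩ := exists_first_zero
        (a := fun i => form (g i) x) (b := fun i => form (g i) u) hu hneg
      have hval : ∀ i, form (g i) (x + r • u) = form (g i) x + r * form (g i) u := by simp
      have hne : x + r • u ≠ 0 := by
        intro h0
        have h1 : form x (x + r • u) = form x x + r * form u x := by
          simp only [form_apply, Prod.fst_add, Prod.snd_add, Prod.smul_fst, Prod.smul_snd,
            smul_eq_mul]; ring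
        rw [h0, map_zero, hux] at h1
        linarith [form_self_pos hx]
      have hcard := card_support_lt (a := fun i => form (g i) x)
        (b := fun i => form (g i) (x + r • u))
        (fun i h => by simp only [hval]; rw [h, hu i h]; ring) ⟨i, hi, by rw [hval]; exact hi0⟩
      obtain ⟨ε, i, j, hij, hcf⟩ := ih (x + r • u) hne (by omega)
      refine ⟨ε, i, j, hij, fun k => ?_⟩
      have h1 := hcf k
      simp only [hval] at h1
      rcases h1 with h1 | h1
      · exact .inl h1
      · rw [h1]; exact hconf k

/-- The signs of the determinants of all triples of forms determine which sign vectors occur: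
every vector is a sum of vectors in its closed cell that are orthogonal to two independent forms,
and the signs of the forms at those vectors are signs of determinants. -/
theorem exists_sign_form_eq {g g' : ι → F × F × F} (hg : ∀ x, (∀ i, form (g i) x = 0) → x = 0)
    (hdet : ∀ i j k, SignType.sign (det3 (g i) (g j) (g k)) =
      SignType.sign (det3 (g' i) (g' j) (g' k)))
    (m : ℕ) (x : F × F × F) (hm : (Finset.univ.filter fun i => form (g i) x ≠ 0).card ≤ m) :
    ∃ x', ∀ i, SignType.sign (form (g' i) x') = SignType.sign (form (g i) x) := by
  induction m generalizing x with
  | zero =>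
    have h0 : ∀ i, form (g i) x = 0 := by simpa [Finset.filter_eq_empty_iff] using hm
    exact ⟨0, fun i => by simp [h0]⟩
  | succ m ih =>
    by_cases hx : x = 0
    · exact ⟨0, by simp [hx]⟩
    obtain ⟨ε, p, q, hne, hconf⟩ := exists_conforming_cross3 hg _ x hx le_rfl
    have hsign : ∀ k, SignType.sign (form (g' k) (ε • cross3 (g' p) (g' q))) =
        SignType.sign (form (g k) (ε • cross3 (g p) (g q))) := fun k => by
      have := hdet p q k
      simp only [det3] at this
      simp [sign_mul, this]
    set v := ε • cross3 (g p) (g q)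
    set v' := ε • cross3 (g' p) (g' q)
    obtain ⟨k, hk⟩ : ∃ k, form (g k) v ≠ 0 := by
      by_contra! h
      exact hne (hg v h)
    have hzero : ∀ i, form (g i) x = 0 → form (g i) v = 0 := fun i hi => by
      simpa [hi] using hconf i
    obtain ⟨r, hr, hcf, i, hi, hvi, hi0⟩ := exists_first_zero
      (a := fun i => form (g i) x) (b := fun i => form (g i) (-v))
      (fun i hi => by simp [hzero i hi]) (by
        refine ⟨k, ?_⟩
        have h1 := (hconf k).resolve_left (by simpa using hk)
        simp only [map_neg, mul_neg, neg_lt_zero]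
        rcases lt_or_gt_of_ne hk with h | h
        · rw [sign_neg h] at h1
          exact mul_pos_of_neg_of_neg (sign_eq_neg_one_iff.1 h1.symm) h
        · rw [sign_pos h] at h1
          exact mul_pos (sign_eq_one_iff.1 h1.symm) h)
    have hval : ∀ i, form (g i) (x - r • v) = form (g i) x + r * form (g i) (-v) := fun i => by
      simp [sub_eq_add_neg]
    obtain ⟨y', hy'⟩ := ih (x - r • v) (by
      have := card_support_lt (a := fun i => form (g i) x) (b := fun i => form (g i) (x - r • v))
        (fun i h => by simp only [hval]; rw [h, map_neg, hzero i h]; ring)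
        ⟨i, hi, by rw [hval]; exact hi0⟩
      omega)
    refine ⟨r • v' + y', fun j => ?_⟩
    have hj : SignType.sign (form (g j) (x - r • v)) = 0 ∨
        SignType.sign (form (g j) (x - r • v)) = SignType.sign (form (g j) x) := by
      rw [hval]; exact hcf j
    by_cases hvj : form (g j) v = 0
    · have h1 : form (g' j) v' = 0 := by rw [← sign_eq_zero_iff, hsign, hvj, sign_zero]
      simp [h1, hy', hvj]
    · have h1 := (hconf j).resolve_left (by simpa using hvj)
      simp only [map_add, map_smul, smul_eq_mul]
      rw [sign_mul_add hr (by rw [hy', hsign, h1]; exact hj), hsign, h1]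

/-! ### Isomorphism from equality of signs -/

/-- The homogeneous forms of a family of lines, together with the form `t` of the line at
infinity. -/
def withInfinity {κ : Type*} (g : κ → F × F × F) : Option κ → F × F × F
  | none => (0, 0, 1)
  | some i => g i

theorem exists_piecewiseLinear_equiv {κ : Type*} [Finite κ] {g g' : κ → F × F × F}
    (hg : ∀ x, (∀ i, form (withInfinity g i) x = 0) → x = 0)
    (hg' : ∀ x, (∀ i, form (withInfinity g' i) x = 0) → x = 0)
    (hdet : ∀ i j k, SignType.sign (det3 (withInfinity g i) (withInfinity g j) (withInfinity g k)) =
      SignType.sign (det3 (withInfinity g' i) (withInfinity g' j) (withInfinity g' k))) :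
    ∃ φ : F × F ≃ F × F, IsPiecewiseLinear φ ∧
      ∀ p i, SignType.sign (form (g' i) ((φ p).1, (φ p).2, 1)) =
        SignType.sign (form (g i) (p.1, p.2, 1)) := by
  classical
  have := Fintype.ofFinite κ
  -- A pair of points with prescribed signs, normalized to the same value of the last coordinate.
  have hpair : ∀ X : Option κ → SignType, ∃ v v' : F × F × F, v.2.2 = v'.2.2 ∧
      (((∃ x, X = fun i => SignType.sign (form (withInfinity g i) x)) ∨
        ∃ x, X = fun i => SignType.sign (form (withInfinity g' i) x)) →
      (∀ i, SignType.sign (form (withInfinity g i) v) = X i) ∧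
      ∀ i, SignType.sign (form (withInfinity g' i) v') = X i) := by
    intro X
    by_cases hX : (∃ x, X = fun i => SignType.sign (form (withInfinity g i) x)) ∨
        ∃ x, X = fun i => SignType.sign (form (withInfinity g' i) x)
    swap
    · exact ⟨0, 0, rfl, fun h => absurd h hX⟩
    obtain ⟨v, v', hv, hv'⟩ : ∃ v v' : F × F × F,
        (∀ i, SignType.sign (form (withInfinity g i) v) = X i) ∧
        ∀ i, SignType.sign (form (withInfinity g' i) v') = X i := by
      rcases hX with ⟨x, rfl⟩ | ⟨x, rfl⟩
      · obtain ⟨x', hx'⟩ := exists_sign_form_eq hg hdet _ x le_rfl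
        exact ⟨x, x', fun _ => rfl, hx'⟩
      · obtain ⟨x', hx'⟩ := exists_sign_form_eq hg' (fun i j k => (hdet i j k).symm) _ x le_rfl
        exact ⟨x', x, hx', fun _ => rfl⟩
    have ht : SignType.sign v.2.2 = SignType.sign v'.2.2 := by
      have h1 := hv none
      rw [← hv' none] at h1
      simpa [form_apply, withInfinity] using h1
    by_cases h0 : v'.2.2 = 0
    · refine ⟨v, v', ?_, fun _ => ⟨hv, hv'⟩⟩
      rw [h0, sign_zero, sign_eq_zero_iff] at ht
      rw [ht, h0]
    · have hr : 0 < v.2.2 / v'.2.2 := by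
        rcases lt_or_gt_of_ne h0 with h | h
        · rw [sign_neg h, sign_eq_neg_one_iff] at ht
          exact div_pos_of_neg_of_neg ht h
        · rw [sign_pos h, sign_eq_one_iff] at ht
          exact div_pos ht h
      refine ⟨v, (v.2.2 / v'.2.2) • v', by simp [div_mul_cancel₀ _ h0], fun _ => ⟨hv, fun i => ?_⟩⟩
      rw [map_smul, smul_eq_mul, sign_mul, sign_pos hr, one_mul, hv']
  choose v v' ht hvv using hpair
  obtain ⟨φ, hsign, hφt, C, hC, hCP, hCU⟩ := exists_conewise_linear_equiv
    (f := fun i => form (withInfinity g i)) (f' := fun i => form (withInfinity g' i))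
    (LinearMap.snd F F F ∘ₗ LinearMap.snd F F (F × F)) (v := v) (v' := v') hg hg'
    (fun x => (hvv _ (.inl ⟨x, rfl⟩)).1) (fun x => (hvv _ (.inl ⟨x, rfl⟩)).2)
    (fun x => (hvv _ (.inr ⟨x, rfl⟩)).1) (fun x => (hvv _ (.inr ⟨x, rfl⟩)).2) (by simpa using ht)
  simp only [LinearMap.comp_apply, LinearMap.snd_apply] at hφt
  have hφ1 : ∀ p : F × F, φ (p.1, p.2, 1) = ((φ (p.1, p.2, 1)).1, (φ (p.1, p.2, 1)).2.1, 1) :=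
    fun p => Prod.ext rfl (Prod.ext rfl (hφt _))
  have hφ2 : ∀ p : F × F, φ.symm (p.1, p.2, 1) =
      ((φ.symm (p.1, p.2, 1)).1, (φ.symm (p.1, p.2, 1)).2.1, 1) := fun p => by
    refine Prod.ext rfl (Prod.ext rfl ?_)
    have := hφt (φ.symm (p.1, p.2, 1))
    rw [φ.apply_symm_apply] at this
    exact this.symm
  refine ⟨⟨fun p => ((φ (p.1, p.2, 1)).1, (φ (p.1, p.2, 1)).2.1),
    fun p => ((φ.symm (p.1, p.2, 1)).1, (φ.symm (p.1, p.2, 1)).2.1), fun p => ?_, fun p => ?_⟩,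
    ?_, fun p i => ?_⟩
  · simp only [← hφ1, φ.symm_apply_apply]
  · simp only [← hφ2, φ.apply_symm_apply]
  · let j : F × F →ᵃ[F] F × F × F :=
      ((LinearMap.fst F F F).prod ((LinearMap.snd F F F).prod 0)).toAffineMap +
        AffineMap.const F (F × F) ((0, 0, 1) : F × F × F)
    have hj : ∀ p, j p = (p.1, p.2, 1) := fun p => by simp [j]
    let π : F × F × F →ₗ[F] F × F :=
      (LinearMap.fst F F (F × F)).prod (LinearMap.fst F F F ∘ₗ LinearMap.snd F F (F × F))
    refine ⟨(fun q => j ⁻¹' q.1) '' C, hC.image _, ?_, ?_⟩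
    · refine Set.eq_univ_of_forall fun p => ?_
      obtain ⟨q, hq, hp⟩ := hCU (j p) trivial
      exact ⟨_, ⟨q, hq, rfl⟩, hp⟩
    · rintro _ ⟨q, hq, rfl⟩
      obtain ⟨⟨H, hH, hqH⟩, hqφ⟩ := hCP q hq
      refine ⟨⟨hH.toFinset.image fun h => (h (1, 0, 0), h (0, 1, 0), -h (0, 0, 1)), ?_⟩,
        (π ∘ₗ q.2).toAffineMap.comp j, fun p hp => ?_⟩
      · ext p
        have key : ∀ h : F × F × F →ₗ[F] F, h (j p) =
            h (1, 0, 0) * p.1 + h (0, 1, 0) * p.2 + h (0, 0, 1) := fun h => by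
          have : j p = p.1 • (1, 0, 0) + p.2 • (0, 1, 0) + (0, 0, 1) := by simp [hj]
          rw [this]
          simp only [map_add, map_smul, smul_eq_mul]
          ring
        simp only [hqH, Set.mem_preimage, Set.mem_ofPred_eq, Finset.forall_mem_image,
          Set.Finite.mem_toFinset, key]
        exact forall₂_congr fun h _ => ⟨fun _ => by linarith, fun _ => by linarith⟩
      · have := hqφ _ hp
        simp only [hj] at this
        simp [π, hj, ← this]
  · have := hsign (p.1, p.2, 1) (some i)
    rw [hφ1] at this
    exact this

end Covectors

section Polygon

variable {F : Type*} [Field F] [LinearOrder F] [IsStrictOrderedRing F]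

/-! ### Directions of lines -/

/-- The vector `d` is a direction vector of the line `L`. -/
def HasDirection (L : PlaneLine F) (d : F × F) : Prop :=
  ∃ l : F, l ≠ 0 ∧ L.a = -(l * d.2) ∧ L.b = l * d.1

theorem HasDirection.of_orthogonal {L : PlaneLine F} {d : F × F} (hd : d ≠ 0)
    (h : L.a * d.1 + L.b * d.2 = 0) : HasDirection L d := by
  have hpos : 0 < d.1 ^ 2 + d.2 ^ 2 := by
    by_cases h1 : d.1 = 0
    · have h2 : d.2 ≠ 0 := fun h2 => hd (Prod.ext h1 h2)
      positivity
    · positivity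
  have h1 : L.a = -((L.b * d.1 - L.a * d.2) / (d.1 ^ 2 + d.2 ^ 2) * d.2) := by
    field_simp
    linear_combination d.1 * h
  have h2 : L.b = (L.b * d.1 - L.a * d.2) / (d.1 ^ 2 + d.2 ^ 2) * d.1 := by
    field_simp
    linear_combination d.2 * h
  refine ⟨_, fun h0 => ?_, h1, h2⟩
  rw [h0, zero_mul] at h1 h2
  rcases L.ne_zero with h3 | h3
  · exact h3 (by simpa using h1)
  · exact h3 h2

theorem HasDirection.ne_zero {L : PlaneLine F} {d : F × F} (h : HasDirection L d) :
    d.1 ≠ 0 ∨ d.2 ≠ 0 := by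
  obtain ⟨l, -, ha, hb⟩ := h
  by_contra! h0
  have := L.ne_zero
  simp [ha, hb, h0] at this

theorem HasDirection.mem_points_iff {L : PlaneLine F} {d p q : F × F} (h : HasDirection L d)
    (hp : p ∈ L.points) : q ∈ L.points ↔ det2 d (q - p) = 0 := by
  obtain ⟨l, hl, ha, hb⟩ := h
  simp only [PlaneLine.points, Set.mem_ofPred_eq, ha, hb] at hp ⊢
  have e : -(l * d.2) * q.1 + l * d.1 * q.2 - L.c = l * det2 d (q - p) := by
    simp only [det2, Prod.fst_sub, Prod.snd_sub]
    linear_combination hp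
  rw [← sub_eq_zero, e, mul_eq_zero, or_iff_right hl]

theorem HasDirection.det2_ne_zero {L M : PlaneLine F} {d e : F × F} (hL : HasDirection L d)
    (hM : HasDirection M e) (h : ¬ L.Parallel M) : det2 d e ≠ 0 := by
  obtain ⟨l, -, ha, hb⟩ := hL
  obtain ⟨m, -, ha', hb'⟩ := hM
  intro h0
  apply h
  simp only [PlaneLine.Parallel, ha, hb, ha', hb']
  simp only [det2] at h0
  linear_combination l * m * h0

/-! ### The vertices of the polygon -/

variable {n : ℕ} [NeZero n]

/-- The vector from the vertex `A i` to the next one. -/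
def side (A : Fin n → F × F) (i : Fin n) : F × F := A (i + 1) - A i

/-- The points `A 0, …, A (n - 1)` are the vertices of a convex polygon, listed anticlockwise, whose
side from `A i` to `A (i + 1)` lies on the `i`-th line. -/
structure IsVertexCycle (ℒ : Fin n → PlaneLine F) (A : Fin n → F × F) : Prop where
  mem : ∀ i, A i ∈ (ℒ i).points
  direction : ∀ i, HasDirection (ℒ i) (side A i)
  det_ne_zero : ∀ i j, i ≠ j → det2 (side A i) (side A j) ≠ 0
  left : ∀ i j, j ≠ i → j ≠ i + 1 → 0 < det2 (side A i) (A j - A i)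

theorem fin_one_ne_zero (hn : 3 ≤ n) : (1 : Fin n) ≠ 0 := by
  rw [Ne, Fin.ext_iff, Fin.val_zero, Fin.val_one', Nat.mod_eq_of_lt (by omega)]
  omega

theorem fin_two_ne_zero (hn : 3 ≤ n) : (1 + 1 : Fin n) ≠ 0 := by
  rw [Ne, Fin.ext_iff, Fin.val_zero, Fin.val_add, Fin.val_one', Nat.mod_eq_of_lt (by omega : 1 < n),
    Nat.mod_eq_of_lt (by omega)]
  omega

theorem exists_isVertexCycle (hn : 3 ≤ n) {ℒ : Fin n → PlaneLine F} (hℒ : IsLineArrangement ℒ)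
    (hgon : IsAnticlockwiseGon ℒ) : ∃ A, IsVertexCycle ℒ A := by
  obtain ⟨R, -, -, P, hP, hseg, -, hleft⟩ := hgon
  have h1 := fin_one_ne_zero hn
  have h2 := fin_two_ne_zero hn
  have hnc : ∀ {i j k p}, i ≠ j → i ≠ k → j ≠ k → p ∈ (ℒ i).points → p ∈ (ℒ j).points →
      p ∈ (ℒ k).points → False := fun hij hik hjk hi hj hk =>
    (hℒ.not_concurrent _ _ _ hij hik hjk).subset ⟨⟨hi, hj⟩, hk⟩
  have hmem : ∀ i, P (i - 1) ∈ (ℒ i).points := fun i => by simpa using (hP (i - 1)).2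
  have hR : ∀ i, P i ∈ R := fun i => by
    have : P i ∈ segment F (P i) (P (i + 1)) := left_mem_segment F _ _
    rw [← hseg] at this
    exact this.2
  have hdir : ∀ i, HasDirection (ℒ i) (side (fun i => P (i - 1)) i) := fun i => by
    have e1 := hmem i
    have e2 := (hP i).1
    refine HasDirection.of_orthogonal (fun h => ?_) ?_
    · have hPP : P i = P (i - 1) := by simpa [side, sub_eq_zero] using h
      refine hnc (i := i - 1) (j := i) (k := i + 1) (by simpa using h1) ?_ (by simpa using h1)
        (hP (i - 1)).1 (hmem i) (hPP ▸ (hP i).2)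
      intro h
      apply h2
      rw [sub_eq_iff_eq_add, add_assoc] at h
      simpa using h
    · simp only [PlaneLine.points, Set.mem_ofPred_eq] at e1 e2
      simp only [side, add_sub_cancel_right, Prod.fst_sub, Prod.snd_sub]
      linear_combination e2 - e1
  -- The side on the line `i` ends at `P i`, so it starts at `P (i - 1)`.
  refine ⟨fun i => P (i - 1), hmem, hdir,
    fun i j hij => (hdir i).det2_ne_zero (hdir j) (hℒ.not_parallel i j hij), fun i j hji hji' => ?_⟩
  refine lt_of_le_of_ne ?_ fun h => ?_
  · simpa [side] using hleft (i - 1) _ (hR (j - 1))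
  · refine hnc (i := j - 1) (j := j) (k := i) (by simpa using h1) ?_ hji (hP (j - 1)).1 (hmem j)
      (((hdir i).mem_points_iff (hmem i)).2 h.symm)
    rwa [Ne, sub_eq_iff_eq_add]

namespace IsVertexCycle

variable {ℒ : Fin n → PlaneLine F} {A : Fin n → F × F}

theorem nonneg (hA : IsVertexCycle ℒ A) (i j : Fin n) : 0 ≤ det2 (side A i) (A j - A i) := by
  by_cases h : j = i
  · simp [h, det2]
  by_cases h' : j = i + 1
  · subst h'
    simp only [side, det2]
    rw [mul_comm, sub_self]
  exact (hA.left i j h h').le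

theorem det_succ_pos (hn : 3 ≤ n) (hA : IsVertexCycle ℒ A) (i : Fin n) :
    0 < det2 (side A i) (side A (i + 1)) := by
  have h := hA.left i (i + 1 + 1) (by rw [add_assoc]; simpa using fin_two_ne_zero hn)
    (by simpa using fin_one_ne_zero hn)
  have e : det2 (side A i) (side A (i + 1)) = det2 (side A i) (A (i + 1 + 1) - A i) := by
    simp only [side, det2, Prod.fst_sub, Prod.snd_sub]; ring
  rwa [e]

/-- Seen from the side `k`, the heights of the vertices have no local minimum away from that side,
because the polygon lies in the angle at each of its vertices. -/
theorem det_neg_succ (hn : 3 ≤ n) (hA : IsVertexCycle ℒ A) {k i : Fin n}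
    (h : det2 (side A k) (side A i) < 0) (hk : i + 1 ≠ k) :
    det2 (side A k) (side A (i + 1)) < 0 := by
  refine lt_of_le_of_ne (not_lt.1 fun hpos => ?_) (hA.det_ne_zero k (i + 1) hk.symm)
  have hik : i + 1 ≠ k + 1 := by
    intro h0
    rw [add_right_cancel h0] at h
    simp [det2, mul_comm] at h
  have h1 := hA.left k (i + 1) hk hik
  have h2 := hA.nonneg i k
  have h3 := hA.nonneg (i + 1) k
  have h4 := hA.det_succ_pos hn i
  have e : det2 (side A k) (A (i + 1) - A k) * det2 (side A i) (side A (i + 1)) =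
      det2 (side A i) (A k - A i) * -det2 (side A k) (side A (i + 1)) +
      det2 (side A (i + 1)) (A k - A (i + 1)) * det2 (side A k) (side A i) := by
    simp only [side, det2, Prod.fst_sub, Prod.snd_sub]; ring
  nlinarith [mul_pos h1 h4, mul_nonneg h2 hpos.le, mul_nonneg h3 (neg_pos.2 h).le]

end IsVertexCycle

/-- Going around the polygon from the side `k`, the sides turn away from the direction of `k`
by less than half a turn up to the one before `k + s`, and by more than half a turn from there
on. -/
def IsSwitch (A : Fin n → F × F) (k s : Fin n) : Prop :=
  (∀ x, x ≠ 0 → x < s → 0 < det2 (side A k) (side A (k + x))) ∧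
    ∀ x, s ≤ x → det2 (side A k) (side A (k + x)) < 0

theorem det2_swap (v w : F × F) : det2 v w = -det2 w v := by
  simp only [det2]; ring

theorem det2_self (v : F × F) : det2 v v = 0 := by
  simp only [det2]; ring

theorem IsVertexCycle.exists_isSwitch (hn : 3 ≤ n) {ℒ : Fin n → PlaneLine F} {A : Fin n → F × F}
    (hA : IsVertexCycle ℒ A) (k : Fin n) : ∃ s, IsSwitch A k s := by
  classical
  let S := Finset.univ.filter fun x => det2 (side A k) (side A (k + x)) < 0
  have hS : S.Nonempty := by
    refine ⟨-1, Finset.mem_filter.2 ⟨Finset.mem_univ _, ?_⟩⟩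
    have := hA.det_succ_pos hn (k - 1)
    rw [sub_add_cancel, det2_swap] at this
    rw [← sub_eq_add_neg]
    linarith
  have hs := (Finset.mem_filter.1 (S.min'_mem hS)).2
  refine ⟨S.min' hS, fun x hx0 hx => ?_, ?_⟩
  · refine lt_of_le_of_ne (not_lt.1 fun h => ?_) (Ne.symm ?_)
    swap
    · exact hA.det_ne_zero k (k + x) (by simpa using hx0)
    exact (S.min'_le x (Finset.mem_filter.2 ⟨Finset.mem_univ _, h⟩)).not_gt hx
  · generalize S.min' hS = s at hs
    have key : ∀ (m : ℕ) (x : Fin n), x.val = s.val + m →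
        det2 (side A k) (side A (k + x)) < 0 := by
      intro m
      induction m with
      | zero => intro x hx; rwa [show x = s from Fin.ext hx]
      | succ m ih =>
        intro x hx
        have hx0 : x ≠ 0 := by rintro rfl; simp at hx
        have h := hA.det_neg_succ hn
          (ih (x - 1) (by rw [Fin.val_sub_one_of_ne_zero hx0]; omega))
          (by rw [add_assoc, sub_add_cancel]; simpa using hx0)
        rwa [add_assoc, sub_add_cancel] at h
    intro x hx
    exact key (x.val - s.val) x (by rw [Fin.le_def] at hx; omega)

namespace IsSwitch

variable {ℒ : Fin n → PlaneLine F} {A : Fin n → F × F} {k s : Fin n}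

theorem ne_zero (hs : IsSwitch A k s) : s ≠ 0 := by
  rintro rfl
  have := hs.2 0 le_rfl
  simp [det2_self] at this

theorem sub_one_ne_zero (hn : 3 ≤ n) (hA : IsVertexCycle ℒ A) (hs : IsSwitch A k s) :
    s - 1 ≠ 0 := by
  rw [Ne, sub_eq_zero]
  rintro rfl
  exact (hA.det_succ_pos hn k).not_gt (hs.2 1 le_rfl)

theorem sub_one_lt (hs : IsSwitch A k s) : s - 1 < s := by
  rw [Fin.lt_def, Fin.val_sub_one_of_ne_zero hs.ne_zero]
  have := Fin.pos_iff_ne_zero.2 hs.ne_zero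
  rw [Fin.lt_def, Fin.val_zero] at this
  omega

end IsSwitch

/-! ### The cyclic order of the directions -/

/-- The line `x` comes before the line `y` if the directions modulo half a turn are listed by
their angle with the side `k`. -/
def Before (A : Fin n → F × F) (k x y : Fin n) : Prop :=
  (x = k ∧ y ≠ k) ∨ (x ≠ k ∧ y ≠ k ∧
    0 < det2 (side A k) (side A x) * det2 (side A k) (side A y) * det2 (side A x) (side A y))

theorem Before.asymm {A : Fin n → F × F} {k x y : Fin n} (h : Before A k x y) :
    ¬ Before A k y x := by
  rintro (⟨h1, h2⟩ | ⟨h1, h2, h3⟩)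
  · rcases h with h | h
    · exact h2 h.1
    · exact h.2.1 h1
  · rcases h with h | h
    · exact h2 h.1
    · rw [det2_swap (side A y)] at h3
      linarith [h.2.2]

/-- The identity behind the transitivity of the order of directions in a half plane. -/
theorem det2_mul_det2 (k x y z : F × F) :
    det2 k y * det2 x z = det2 k x * det2 y z + det2 k z * det2 x y := by
  simp only [det2]; ring

namespace IsSwitch

variable {ℒ : Fin n → PlaneLine F} {A : Fin n → F × F} {k s : Fin n}

/-- Within each of the two half turns seen from the side `k`, the sides turn left. -/
theorem det_pos (hn : 3 ≤ n) (hA : IsVertexCycle ℒ A) (hs : IsSwitch A k s) {x y : Fin n}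
    (hx : x ≠ 0) (hxy : x < y) (h : y < s ∨ s ≤ x) :
    0 < det2 (side A (k + x)) (side A (k + y)) := by
  have key : ∀ (m : ℕ) (y : Fin n), y.val = x.val + m + 1 → (y < s ∨ s ≤ x) →
      0 < det2 (side A (k + x)) (side A (k + y)) := by
    intro m
    induction m with
    | zero =>
      intro y hy _
      have hy0 : y ≠ 0 := by rintro rfl; simp at hy
      have hyx : y - 1 = x := Fin.ext (by rw [Fin.val_sub_one_of_ne_zero hy0]; omega)
      have := hA.det_succ_pos hn (k + x)
      rwa [add_assoc, ← hyx, sub_add_cancel, hyx] at this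
    | succ m ih =>
      intro y hy h
      have hy0 : y ≠ 0 := by rintro rfl; simp at hy
      have hv : (y - 1).val = x.val + m + 1 := by rw [Fin.val_sub_one_of_ne_zero hy0]; omega
      have hy1 : y - 1 ≠ 0 := by intro h0; rw [h0] at hv; simp at hv
      have h1 := ih (y - 1) hv (h.imp_left fun h => by rw [Fin.lt_def] at h ⊢; omega)
      have h2 := hA.det_succ_pos hn (k + (y - 1))
      rw [add_assoc, sub_add_cancel] at h2
      have e := det2_mul_det2 (side A k) (side A (k + x)) (side A (k + (y - 1))) (side A (k + y))
      rcases h with h | h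
      · have a1 := hs.1 x hx (by rw [Fin.lt_def] at h ⊢; omega)
        have a2 := hs.1 (y - 1) hy1 (by rw [Fin.lt_def] at h ⊢; omega)
        have a3 := hs.1 y hy0 h
        rw [← mul_pos_iff_of_pos_left a2, e]
        positivity
      · rw [Fin.le_def] at h
        have a1 := hs.2 x (by rw [Fin.le_def]; omega)
        have a2 := hs.2 (y - 1) (by rw [Fin.le_def]; omega)
        have a3 := hs.2 y (by rw [Fin.le_def]; omega)
        refine pos_of_mul_neg_right ?_ a2.le
        rw [e]
        exact add_neg (mul_neg_of_neg_of_pos a1 h2) (mul_neg_of_neg_of_pos a3 h1)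
  exact key (y.val - x.val - 1) y (by rw [Fin.lt_def] at hxy; omega) h

theorem before (hn : 3 ≤ n) (hA : IsVertexCycle ℒ A) (hs : IsSwitch A k s) {x y : Fin n}
    (hxy : x < y) (h : y < s ∨ s ≤ x) : Before A k (k + x) (k + y) := by
  have hy : y ≠ 0 := Fin.pos_iff_ne_zero.1 (lt_of_le_of_lt (Fin.zero_le x) hxy)
  by_cases hx : x = 0
  · exact .inl ⟨by simp [hx], by simpa using hy⟩
  · refine .inr ⟨by simpa using hx, by simpa using hy, mul_pos ?_ (hs.det_pos hn hA hx hxy h)⟩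
    rcases h with h | h
    · exact mul_pos (hs.1 x hx (hxy.trans h)) (hs.1 y hy h)
    · exact mul_pos_of_neg_of_neg (hs.2 x h) (hs.2 y (h.trans hxy.le))

/-- The only descent of the slopes is at the switch. -/
theorem before_sub_one (hn : 3 ≤ n) (hA : IsVertexCycle ℒ A) (hs : IsSwitch A k s) :
    Before A k (k + s) (k + (s - 1)) := by
  refine .inr ⟨by simpa using hs.ne_zero, by simpa using hs.sub_one_ne_zero hn hA, ?_⟩
  have h1 := hs.1 (s - 1) (hs.sub_one_ne_zero hn hA) hs.sub_one_lt
  have h2 := hs.2 s le_rfl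
  have h3 := hA.det_succ_pos hn (k + (s - 1))
  rw [add_assoc, sub_add_cancel, det2_swap] at h3
  exact mul_pos_of_neg_of_neg (mul_neg_of_neg_of_pos h2 h1) (by linarith)

end IsSwitch

/-! ### Signs of the triple determinants -/

/-- The homogeneous form of the `i`-th side line, positive on the left of the side. -/
def sideForm (A : Fin n → F × F) (i : Fin n) : F × F × F :=
  (-(side A i).2, (side A i).1, -det2 (side A i) (A i))

theorem form_sideForm (A : Fin n → F × F) (i : Fin n) (p : F × F) :
    form (sideForm A i) (p.1, p.2, 1) = det2 (side A i) (p - A i) := by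
  simp only [form_apply, sideForm, det2, Prod.fst_sub, Prod.snd_sub]; ring

/-- Each side contains a point that is strictly on the left of all other sides. -/
theorem IsVertexCycle.exists_mem_side (hn : 3 ≤ n) {ℒ : Fin n → PlaneLine F} {A : Fin n → F × F}
    (hA : IsVertexCycle ℒ A) (i : Fin n) :
    ∃ p : F × F, form (sideForm A i) (p.1, p.2, 1) = 0 ∧
      ∀ j, j ≠ i → 0 < form (sideForm A j) (p.1, p.2, 1) := by
  have hmid : ∀ j, form (sideForm A j) ((A i + A (i + 1)).1 / 2, (A i + A (i + 1)).2 / 2, 1) =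
      (det2 (side A j) (A i - A j) + det2 (side A j) (A (i + 1) - A j)) / 2 := fun j => by
    simp only [form_apply, sideForm, det2, Prod.fst_sub, Prod.snd_sub, Prod.fst_add, Prod.snd_add]
    ring
  refine ⟨((A i + A (i + 1)).1 / 2, (A i + A (i + 1)).2 / 2), ?_, fun j hj => ?_⟩
  · rw [hmid]
    simp only [side, det2, Prod.fst_sub, Prod.snd_sub]
    ring
  · rw [hmid]
    have h1 := hA.nonneg j i
    have h2 := hA.nonneg j (i + 1)
    refine half_pos ?_
    by_cases h : i = j + 1
    · refine add_pos_of_nonneg_of_pos h1 (hA.left j (i + 1) ?_ (by simpa using hj.symm))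
      rw [h, add_assoc]
      simpa using fin_two_ne_zero hn
    · exact add_pos_of_pos_of_nonneg (hA.left j i hj.symm h) h2

/-- Cramer's rule for three lines of the plane. -/
theorem det3_sideForm (A : Fin n → F × F) (i j k : Fin n) (p : F × F) :
    det3 (sideForm A i) (sideForm A j) (sideForm A k) =
      det2 (side A j) (side A k) * form (sideForm A i) (p.1, p.2, 1) +
      det2 (side A k) (side A i) * form (sideForm A j) (p.1, p.2, 1) +
      det2 (side A i) (side A j) * form (sideForm A k) (p.1, p.2, 1) := by
  simp only [det3, cross3, form_apply, sideForm, det2]; ring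

end Polygon

section Slopes

variable {F : Type*} [Field F] [LinearOrder F] [IsStrictOrderedRing F]

/-! ### The slope order in terms of determinants -/

theorem HasDirection.slope_eq {L : PlaneLine F} {d : F × F} (h : HasDirection L d) :
    (d.1 = 0 → L.slope = ⊤) ∧ (d.1 ≠ 0 → L.slope = ((d.2 / d.1 : F) : WithTop F)) := by
  obtain ⟨l, hl, ha, hb⟩ := h
  refine ⟨fun h0 => ?_, fun h0 => ?_⟩
  · rw [PlaneLine.slope, if_pos (by rw [hb, h0, mul_zero])]
  · rw [PlaneLine.slope, if_neg (by rw [hb]; exact mul_ne_zero hl h0), ha, hb]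
    congr 1
    field_simp

theorem HasDirection.smul {L : PlaneLine F} {d : F × F} (h : HasDirection L d) {r : F}
    (hr : r ≠ 0) : HasDirection L (r • d) := by
  obtain ⟨l, hl, ha, hb⟩ := h
  refine ⟨l / r, div_ne_zero hl hr, ?_, ?_⟩
  · rw [ha, Prod.smul_snd, smul_eq_mul]; field_simp
  · rw [hb, Prod.smul_fst, smul_eq_mul]; field_simp

/-- The angle of the vector `d` is in `[0, π)`. -/
def IsUpper (d : F × F) : Prop := 0 < d.2 ∨ (d.2 = 0 ∧ 0 < d.1)

theorem exists_sign_isUpper {d : F × F} (h : d.1 ≠ 0 ∨ d.2 ≠ 0) :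
    ∃ η : F, (η = 1 ∨ η = -1) ∧ IsUpper (η • d) := by
  rcases lt_trichotomy d.2 0 with h2 | h2 | h2
  · exact ⟨-1, .inr rfl, .inl (by simpa using h2)⟩
  · rcases lt_or_gt_of_ne (h.resolve_right (not_not.2 h2)) with h1 | h1
    · exact ⟨-1, .inr rfl, .inr ⟨by simp [h2], by simpa using h1⟩⟩
    · exact ⟨1, .inl rfl, .inr ⟨by simp [h2], by simpa using h1⟩⟩
  · exact ⟨1, .inl rfl, .inl (by simpa using h2)⟩

theorem IsUpper.div_nonneg_iff {d : F × F} (hd : IsUpper d) (h : d.1 ≠ 0) :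
    0 ≤ d.2 / d.1 ↔ 0 < d.1 := by
  refine ⟨fun h0 => ?_, fun h0 => ?_⟩
  · rcases hd with h2 | h2
    · refine lt_of_le_of_ne (not_lt.1 fun h1 => ?_) h.symm
      exact (div_neg_of_pos_of_neg h2 h1).not_ge h0
    · exact h2.2
  · rcases hd with h2 | h2
    · exact div_nonneg h2.le h0.le
    · rw [h2.1, zero_div]

/-- On angles in `[0, π)` the slope order is the order of the angles. -/
theorem slopeLT_iff {L M : PlaneLine F} {d e : F × F} (hL : HasDirection L d)
    (hM : HasDirection M e) (hd : IsUpper d) (he : IsUpper e) :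
    SlopeLT L.slope M.slope ↔ 0 < det2 d e := by
  have hd2 : 0 ≤ d.2 := hd.elim le_of_lt fun h => h.1.ge
  have he2 : 0 ≤ e.2 := he.elim le_of_lt fun h => h.1.ge
  have hpos : ∀ {w : F × F}, IsUpper w → w.1 ≤ 0 → 0 < w.2 := fun hw h =>
    hw.elim id fun h' => absurd h'.2 h.not_gt
  unfold SlopeLT det2
  by_cases h1 : d.1 = 0 <;> by_cases h2 : e.1 = 0
  · rw [hL.slope_eq.1 h1, hM.slope_eq.1 h2]
    simp [h1, h2]
  · rw [hL.slope_eq.1 h1, hM.slope_eq.2 h2]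
    have h3 := he.div_nonneg_iff h2
    have h4 := hpos hd h1.le
    have : ((e.2 / e.1 : F) : WithTop F) < 0 ↔ e.1 < 0 := by
      rw [← WithTop.coe_zero, WithTop.coe_lt_coe, ← not_le, h3, not_lt, le_iff_lt_or_eq,
        or_iff_left h2]
    simp [this, h1, mul_neg_iff, h4, h4.not_gt]
  · rw [hL.slope_eq.2 h1, hM.slope_eq.1 h2]
    have h3 := hd.div_nonneg_iff h1
    have h4 := hpos he h2.le
    have : 0 ≤ ((d.2 / d.1 : F) : WithTop F) ↔ 0 < d.1 := by
      rw [← WithTop.coe_zero, WithTop.coe_le_coe, h3]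
    simp [this, h2, h4]
  · rw [hL.slope_eq.2 h1, hM.slope_eq.2 h2]
    rw [← WithTop.coe_zero, WithTop.coe_le_coe, WithTop.coe_le_coe, WithTop.coe_lt_coe,
      WithTop.coe_lt_coe, ← not_le, hd.div_nonneg_iff h1, he.div_nonneg_iff h2]
    rcases lt_or_gt_of_ne h1 with h3 | h3 <;> rcases lt_or_gt_of_ne h2 with h4 | h4
    · have : d.2 / d.1 < e.2 / e.1 ↔ 0 < d.1 * e.2 - d.2 * e.1 := by
        rw [← neg_div_neg_eq, ← neg_div_neg_eq e.2, div_lt_div_iff₀ (by linarith) (by linarith),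
          ← sub_pos]
        ring_nf
      simp only [h3.not_gt, h4.not_gt, this]; tauto
    · have := hpos hd h3.le
      have : ¬ 0 < d.1 * e.2 - d.2 * e.1 := by
        nlinarith [mul_pos this h4, mul_nonneg (neg_pos.2 h3).le he2]
      simp only [h3.not_gt, h4, this]; tauto
    · have := hpos he h4.le
      have : 0 < d.1 * e.2 - d.2 * e.1 := by
        nlinarith [mul_pos h3 this, mul_nonneg hd2 (neg_pos.2 h4).le]
      simp only [h3, h4.not_gt, this]; tauto
    · have : d.2 / d.1 < e.2 / e.1 ↔ 0 < d.1 * e.2 - d.2 * e.1 := by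
        rw [div_lt_div_iff₀ h3 h4, ← sub_pos, mul_comm e.2]
      simp only [h3, h4, this]; tauto

theorem HasDirection.rotate {L : PlaneLine F} {d : F × F} (hd : HasDirection L d) {u v : F}
    (h : u ≠ 0 ∨ v ≠ 0) :
    HasDirection (L.rotate u v h) (u * d.1 - v * d.2, v * d.1 + u * d.2) := by
  obtain ⟨l, hl, ha, hb⟩ := hd
  refine ⟨l, hl, ?_, ?_⟩
  · simp only [PlaneLine.rotate, ha, hb]; ring
  · simp only [PlaneLine.rotate, ha, hb]; ring

theorem sq_add_sq_pos {u v : F} (h : u ≠ 0 ∨ v ≠ 0) : 0 < u ^ 2 + v ^ 2 := by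
  rcases h with h | h <;> positivity

/-- After any rotation, the slope order of the lines is given by the determinants of their
directions, up to a choice of orientation for every line. -/
theorem exists_signs_slopeLT {κ : Type*} {ℒ : κ → PlaneLine F} {d : κ → F × F}
    (hd : ∀ i, HasDirection (ℒ i) (d i)) {u v : F} (h : u ≠ 0 ∨ v ≠ 0) :
    ∃ η : κ → F, (∀ i, η i = 1 ∨ η i = -1) ∧ ∀ i j,
      SlopeLT ((ℒ i).rotate u v h).slope ((ℒ j).rotate u v h).slope ↔
        0 < η i * η j * det2 (d i) (d j) := by
  choose η hη hup using fun i => exists_sign_isUpper ((hd i).rotate h).ne_zero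
  refine ⟨η, hη, fun i j => ?_⟩
  have hne : ∀ i, η i ≠ 0 := fun i => by rcases hη i with h | h <;> simp [h]
  rw [slopeLT_iff (((hd i).rotate h).smul (hne i)) (((hd j).rotate h).smul (hne j)) (hup i) (hup j),
    ← mul_pos_iff_of_pos_left (sq_add_sq_pos h) (b := η i * η j * det2 (d i) (d j))]
  simp only [det2, Prod.smul_mk, smul_eq_mul]
  ring_nf

theorem slopeLT_trans {a b c : WithTop F} (h₁ : SlopeLT a b) (h₂ : SlopeLT b c) :
    SlopeLT a c := by
  unfold SlopeLT at *
  have := @lt_trans _ _ a b c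
  simp only [← not_le] at *
  tauto

end Slopes

section Switch

variable {F : Type*} [Field F] [LinearOrder F] [IsStrictOrderedRing F]
variable {n : ℕ} [NeZero n] {ℒ : Fin n → PlaneLine F} {A : Fin n → F × F} {k s : Fin n}

/-! ### The opposite vertex -/

/-- An orientation of the lines for which `k` comes first orders the other lines like `Before`. -/
theorem before_iff_of_signs {η : Fin n → F} (hη : ∀ i, η i = 1 ∨ η i = -1)
    (hk : ∀ y, y ≠ k → 0 < η k * η y * det2 (side A k) (side A y)) (x y : Fin n) :
    0 < η x * η y * det2 (side A x) (side A y) ↔ Before A k x y := by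
  unfold Before
  by_cases hx : x = k
  · subst hx
    by_cases hy : y = x
    · simp [hy, det2_self]
    · simp [hy, hk y hy]
  by_cases hy : y = k
  · subst hy
    have := hk x hx
    rw [det2_swap] at this
    simp only [hx, ne_eq, not_true_eq_false, and_false, false_and, or_false, iff_false, not_lt]
    linarith
  have hsq : ∀ i, η i * η i = 1 := fun i => by rcases hη i with h | h <;> simp [h]
  have e : det2 (side A k) (side A x) * det2 (side A k) (side A y) * det2 (side A x) (side A y) =
      (η k * η x * det2 (side A k) (side A x)) * (η k * η y * det2 (side A k) (side A y)) *
        (η x * η y * det2 (side A x) (side A y)) := by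
    linear_combination (-(det2 (side A k) (side A x) * det2 (side A k) (side A y) *
      det2 (side A x) (side A y))) * ((η x * η x) * (η y * η y) * hsq k +
        (η y * η y) * hsq x + hsq y)
  rw [e, mul_pos_iff_of_pos_left (mul_pos (hk x hx) (hk y hy))]
  simp [hx, hy]

/-- A division of the lines into two runs that are increasing from the side `k` is at the
switch. -/
theorem IsSwitch.eq_of_runs (hn : 3 ≤ n) (hA : IsVertexCycle ℒ A) (hs : IsSwitch A k s)
    {j : Fin n} (h₁ : ∀ x y, x < y → y < j → Before A k (k + x) (k + y))
    (h₂ : ∀ x y, j ≤ x → x < y → Before A k (k + x) (k + y)) : j = s := by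
  have hd := (hs.before_sub_one hn hA).asymm
  have hlt := hs.sub_one_lt
  rcases lt_trichotomy j s with h | h | h
  · refine absurd (h₂ (s - 1) s ?_ hlt) hd
    rw [Fin.le_def, Fin.val_sub_one_of_ne_zero hs.ne_zero]
    rw [Fin.lt_def] at h
    omega
  · exact h
  · exact absurd (h₁ (s - 1) s hlt h) hd

theorem IsSwitch.hasSlopeStructure_iff (hn : 3 ≤ n) (hA : IsVertexCycle ℒ A)
    (hs : IsSwitch A k s) (j : Fin n) :
    (∃ (u v : F) (h : u ≠ 0 ∨ v ≠ 0),
      HasSlopeStructure (fun i => ((ℒ (k + i)).rotate u v h).slope) j) ↔ j = s := by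
  constructor
  · rintro ⟨u, v, h, H⟩
    obtain ⟨η, hη, hlt⟩ := exists_signs_slopeLT hA.direction h
    have hk : ∀ y, y ≠ k → 0 < η k * η y * det2 (side A k) (side A y) := by
      intro y hy
      obtain ⟨x, rfl⟩ : ∃ x, y = k + x := ⟨y - k, by simp⟩
      rw [← hlt]
      have hx : x ≠ 0 := by simpa using hy
      have h0 : SlopeLT ((ℒ (k + 0)).rotate u v h).slope ((ℒ (k + x)).rotate u v h).slope := by
        rcases lt_trichotomy x j with hxj | hxj | hxj
        · exact H.first 0 x (Fin.pos_iff_ne_zero.2 hx) hxj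
        · exact hxj ▸ H.least
        · exact slopeLT_trans H.least (H.second j x le_rfl hxj)
      rwa [add_zero] at h0
    exact hs.eq_of_runs hn hA
      (fun x y hxy hy => (before_iff_of_signs hη hk _ _).1 ((hlt _ _).1 (H.first x y hxy hy)))
      (fun x y hx hxy => (before_iff_of_signs hη hk _ _).1 ((hlt _ _).1 (H.second x y hx hxy)))
  · rintro rfl
    -- The rotation that makes the side `k` horizontal.
    have h : (side A k).1 ≠ 0 ∨ -(side A k).2 ≠ 0 := by
      simpa using (hA.direction k).ne_zero
    obtain ⟨η, hη, hlt⟩ := exists_signs_slopeLT hA.direction h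
    have hslope : ((ℒ k).rotate _ _ h).slope = 0 := by
      have h1 := ((hA.direction k).rotate h).slope_eq
      have h2 := sq_add_sq_pos (hA.direction k).ne_zero
      rw [h1.2 (by nlinarith)]
      norm_cast
      rw [div_eq_zero_iff]
      left
      ring
    have hk : ∀ y, y ≠ k → 0 < η k * η y * det2 (side A k) (side A y) := by
      intro y hy
      by_contra hneg
      have hne : η y * η k * det2 (side A y) (side A k) ≠ 0 := by
        refine mul_ne_zero (mul_ne_zero ?_ ?_) (hA.det_ne_zero y k hy)
        · rcases hη y with h | h <;> simp [h]
        · rcases hη k with h | h <;> simp [h]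
      have hpos : 0 < η y * η k * det2 (side A y) (side A k) := by
        refine lt_of_le_of_ne ?_ hne.symm
        rw [det2_swap]
        linarith
      rw [← hlt, hslope] at hpos
      rcases hpos with h | h
      · exact lt_irrefl _ h.2
      · exact h.2.not_ge (h.1.2 le_rfl)
    have hlt' : ∀ x y, SlopeLT ((ℒ (k + x)).rotate _ _ h).slope ((ℒ (k + y)).rotate _ _ h).slope ↔
        Before A k (k + x) (k + y) := fun x y =>
      (hlt _ _).trans (before_iff_of_signs hη hk _ _)
    refine ⟨_, _, h, Fin.pos_iff_ne_zero.2 hs.ne_zero, ?_,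
      fun x y hxy hy => (hlt' x y).2 (hs.before hn hA hxy (.inl hy)),
      fun x y hx hxy => (hlt' x y).2 (hs.before hn hA hxy (.inr hx)),
      (hlt' 0 j).2 (.inl ⟨add_zero k, by simpa using hs.ne_zero⟩),
      (hlt' j (j - 1)).2 (hs.before_sub_one hn hA)⟩
    simp only [add_zero, hslope, le_refl]

theorem IsSwitch.isOppositeVertex_iff (hn : 3 ≤ n) (hA : IsVertexCycle ℒ A)
    (hs : IsSwitch A k s) (j : Fin n) : IsOppositeVertex ℒ k j ↔ j + 1 - k = s :=
  hs.hasSlopeStructure_iff hn hA _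

end Switch

section Infinity

variable {F : Type*} [Field F] [LinearOrder F] [IsStrictOrderedRing F]
variable {n : ℕ} [NeZero n] {ℒ : Fin n → PlaneLine F} {A : Fin n → F × F} {k s : Fin n}

/-! ### The cycle at infinity -/

theorem exists_mem_points {L M : PlaneLine F} (h : ¬ L.Parallel M) :
    ∃ p, p ∈ L.points ∧ p ∈ M.points := by
  have h0 : L.a * M.b - M.a * L.b ≠ 0 := sub_ne_zero.2 h
  refine ⟨((L.c * M.b - M.c * L.b) / (L.a * M.b - M.a * L.b),
    (L.a * M.c - M.a * L.c) / (L.a * M.b - M.a * L.b)), ?_, ?_⟩ <;>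
  · simp only [PlaneLine.points, Set.mem_ofPred_eq]
    rw [← mul_div_assoc, ← mul_div_assoc, ← add_div, div_eq_iff h0]
    ring

theorem eq_of_mem_points {L M : PlaneLine F} (h : ¬ L.Parallel M) {p q : F × F}
    (hp : p ∈ L.points) (hp' : p ∈ M.points) (hq : q ∈ L.points) (hq' : q ∈ M.points) : p = q := by
  have h0 : L.a * M.b - M.a * L.b ≠ 0 := sub_ne_zero.2 h
  simp only [PlaneLine.points, Set.mem_ofPred_eq] at *
  refine Prod.ext (mul_left_cancel₀ h0 ?_) (mul_left_cancel₀ h0 ?_)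
  · linear_combination M.b * (hp - hq) - L.b * (hp' - hq')
  · linear_combination L.a * (hp' - hq') - M.a * (hp - hq)

theorem exists_isCycleAtInfinity (hℒ : IsLineArrangement ℒ) :
    ∃ σ : Equiv.Perm (Fin n), IsCycleAtInfinity ℒ σ := by
  classical
  -- The line is `x + m y = c`, where `m` keeps it from being parallel to a line of the arrangement
  -- and `c` is beyond all intersection points.
  obtain ⟨m, hm⟩ := Infinite.exists_notMem_finset
    (Finset.univ.image fun i => (ℒ i).b / (ℒ i).a)
  have hm' : ∀ i, (ℒ i).b ≠ (ℒ i).a * m := by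
    intro i h
    have ha : (ℒ i).a ≠ 0 := fun h0 =>
      (ℒ i).ne_zero.elim (fun h1 => h1 h0) fun h1 => h1 (by simp [h, h0])
    exact hm (Finset.mem_image.2 ⟨i, Finset.mem_univ i, by rw [h]; field_simp⟩)
  have hpt : ∀ q : Fin n × Fin n, ∃ v : F, q.1 ≠ q.2 →
      ∀ p ∈ (ℒ q.1).points ∩ (ℒ q.2).points, p.1 + m * p.2 < v := by
    rintro ⟨i, j⟩
    by_cases hij : i = j
    · exact ⟨0, fun h => absurd hij h⟩
    obtain ⟨p, hp, hp'⟩ := exists_mem_points (hℒ.not_parallel i j hij)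
    refine ⟨p.1 + m * p.2 + 1, fun _ q hq => ?_⟩
    rw [eq_of_mem_points (hℒ.not_parallel i j hij) hq.1 hq.2 hp hp']
    linarith
  choose v hv using hpt
  obtain ⟨B, hB⟩ := (Set.finite_range v).bddAbove
  let M : PlaneLine F := ⟨1, m, max B 1, .inl one_ne_zero⟩
  have hpar : ∀ i, ¬ M.Parallel (ℒ i) := fun i h => hm' i (by
    simpa [PlaneLine.Parallel, M] using h)
  have hfar : ∀ i j, i ≠ j → ∀ p ∈ (ℒ i).points ∩ (ℒ j).points, M.a * p.1 + M.b * p.2 < M.c := by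
    intro i j hij p hp
    have h1 := hv (i, j) hij p hp
    have h2 := hB ⟨(i, j), rfl⟩
    simp only [M, one_mul]
    exact lt_of_lt_of_le h1 (h2.trans (le_max_left _ _))
  choose P hPM hP using fun i => exists_mem_points (hpar i)
  let w : Fin n → F := fun i => -M.b * (P i).1 + M.a * (P i).2
  have hw : Function.Injective w := by
    intro i j hij
    by_contra hne
    have hPP : P i = P j := by
      have e1 := hPM i
      have e2 := hPM j
      simp only [PlaneLine.points, Set.mem_ofPred_eq, M, w, one_mul] at e1 e2 hij
      have h0 : 1 + m ^ 2 ≠ 0 := by positivity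
      refine Prod.ext (mul_left_cancel₀ h0 ?_) (mul_left_cancel₀ h0 ?_)
      · linear_combination (e1 - e2) - m * hij
      · linear_combination m * (e1 - e2) + hij
    exact (hfar i j hne (P i) ⟨hP i, hPP ▸ hP j⟩).ne (hPM i)
  let e := Tuple.sort w
  have he : StrictMono (w ∘ e) :=
    (Tuple.monotone_sort w).strictMono_of_injective (hw.comp e.injective)
  refine ⟨e.symm.trans ((Equiv.addRight 1).trans e), M, lt_of_lt_of_le one_pos (le_max_right _ _),
    hpar, hfar, e, fun s t hst p hp q hq => ?_, fun t => by simp⟩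
  rw [eq_of_mem_points (hpar _) hp.1 hp.2 (hPM _) (hP _),
    eq_of_mem_points (hpar _) hq.1 hq.2 (hPM _) (hP _)]
  exact he hst

/-- The lines meet a line far away in the order of their directions, if they are oriented
towards the far side. -/
theorem IsCycleAtInfinity.exists_signs (hℒ : IsLineArrangement ℒ) (hA : IsVertexCycle ℒ A)
    {σ : Equiv.Perm (Fin n)} (hσ : IsCycleAtInfinity ℒ σ) :
    ∃ (e : Equiv.Perm (Fin n)) (η : Fin n → F), (∀ i, η i = 1 ∨ η i = -1) ∧
      (∀ s t, s < t → 0 < η (e s) * η (e t) * det2 (side A (e s)) (side A (e t))) ∧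
      ∀ t, σ (e t) = e (t + 1) := by
  obtain ⟨M, -, hpar, hfar, e, he, heσ⟩ := hσ
  have hη : ∀ i, ∃ η : F, (η = 1 ∨ η = -1) ∧
      0 < η * (M.a * (side A i).1 + M.b * (side A i).2) := by
    intro i
    obtain ⟨l, hl, ha, hb⟩ := hA.direction i
    have h0 : M.a * (side A i).1 + M.b * (side A i).2 ≠ 0 := fun h => hpar i (by
      simp only [PlaneLine.Parallel, ha, hb]; linear_combination l * h)
    rcases lt_or_gt_of_ne h0 with h | h
    · exact ⟨-1, .inr rfl, by linarith⟩
    · exact ⟨1, .inl rfl, by linarith⟩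
  choose η hη hpos using hη
  refine ⟨e, η, hη, fun s t hst => ?_, heσ⟩
  have hne : e s ≠ e t := fun h => hst.ne (e.injective h)
  have h0 := he s t hst
  generalize e s = i at *
  generalize e t = j at *
  obtain ⟨p, hpi, hpj⟩ := exists_mem_points (hℒ.not_parallel i j hne)
  have hδ := sub_pos.2 (hfar i j hne p ⟨hpi, hpj⟩)
  -- The line `i` meets `M` at `p` plus a positive multiple of its oriented direction.
  have hmeet : ∀ i, p ∈ (ℒ i).points → p + ((M.c - (M.a * p.1 + M.b * p.2)) /
      (η i * (M.a * (side A i).1 + M.b * (side A i).2)) * η i) • side A i ∈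
        M.points ∩ (ℒ i).points := by
    intro i hp
    refine ⟨?_, ?_⟩
    · have := (hpos i).ne'
      have h1 : η i ≠ 0 := left_ne_zero_of_mul this
      have h2 := right_ne_zero_of_mul this
      simp only [PlaneLine.points, Set.mem_ofPred_eq, Prod.fst_add, Prod.snd_add, Prod.smul_fst,
        Prod.smul_snd, smul_eq_mul]
      field_simp
      ring
    · rw [(hA.direction i).mem_points_iff hp]
      simp only [det2, add_sub_cancel_left, Prod.smul_fst, Prod.smul_snd, smul_eq_mul]
      ring
  have h1 := h0 _ (hmeet i hpi) _ (hmeet j hpj)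
  have hi := hpos i
  have hj := hpos j
  set mi := η i * (M.a * (side A i).1 + M.b * (side A i).2) with hmi
  set mj := η j * (M.a * (side A j).1 + M.b * (side A j).2) with hmj
  set δ := M.c - (M.a * p.1 + M.b * p.2)
  simp only [Prod.fst_add, Prod.snd_add, Prod.smul_fst, Prod.smul_snd, smul_eq_mul] at h1
  have h2 : 0 < δ / (mi * mj) *
      ((M.a ^ 2 + M.b ^ 2) * (η i * η j * det2 (side A i) (side A j))) := by
    have e : δ / (mi * mj) * ((M.a ^ 2 + M.b ^ 2) * (η i * η j * det2 (side A i) (side A j))) =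
        δ / mj * η j * (-M.b * (side A j).1 + M.a * (side A j).2) -
        δ / mi * η i * (-M.b * (side A i).1 + M.a * (side A i).2) := by
      field_simp
      rw [hmi, hmj]
      simp only [det2]
      ring
    rw [e]
    linarith
  rw [mul_pos_iff_of_pos_left (div_pos hδ (mul_pos hi hj)),
    mul_pos_iff_of_pos_left (sq_add_sq_pos M.ne_zero)] at h2
  exact h2

/-- Translation of `Fin n` by `t₀` preserves the cyclic order of `0`, `s` and `t`. -/
theorem fin_rotate_cases {t₀ s t : Fin n} (hs : s ≠ 0) (hst : s < t) :
    (t₀ < s + t₀ ∧ s + t₀ < t + t₀) ∨ (s + t₀ < t + t₀ ∧ t + t₀ < t₀) ∨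
      (t + t₀ < t₀ ∧ t₀ < s + t₀) := by
  have h0 : 0 < s.val := Fin.pos_iff_ne_zero.2 hs
  simp only [Fin.lt_def, Fin.val_add_eq_ite] at *
  have := s.2
  have := t.2
  have := t₀.2
  split_ifs <;> omega

/-- The cycle at infinity, written from the letter `k` on, lists the lines by the angle of their
directions with the side `k`. -/
theorem IsCycleAtInfinity.exists_sorted (hℒ : IsLineArrangement ℒ) (hA : IsVertexCycle ℒ A)
    {σ : Equiv.Perm (Fin n)} (hσ : IsCycleAtInfinity ℒ σ) (k : Fin n) :
    ∃ e : Equiv.Perm (Fin n), e 0 = k ∧ (∀ t, σ (e t) = e (t + 1)) ∧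
      ∀ s t, s < t → Before A k (e s) (e t) := by
  obtain ⟨e, η, hη, hlt, heσ⟩ := hσ.exists_signs hℒ hA
  obtain ⟨t₀, rfl⟩ := e.surjective k
  refine ⟨(Equiv.addRight t₀).trans e, by simp, fun t => ?_, fun s t hst => ?_⟩
  · simp only [Equiv.trans_apply, Equiv.coe_addRight, heσ]
    rw [add_right_comm]
  · simp only [Equiv.trans_apply, Equiv.coe_addRight]
    have ht : t ≠ 0 := Fin.pos_iff_ne_zero.1 (lt_of_le_of_lt (Fin.zero_le s) hst)
    by_cases hs : s = 0
    · exact .inl ⟨by simp [hs], by simpa using ht⟩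
    refine .inr ⟨by simpa using hs, by simpa using ht, ?_⟩
    have hsq : ∀ i, η i * η i = 1 := fun i => by rcases hη i with h | h <;> simp [h]
    have hgt : ∀ s t, s < t → η (e t) * η (e s) * det2 (side A (e t)) (side A (e s)) < 0 :=
      fun s t h => by rw [det2_swap]; linarith [hlt s t h]
    -- The product of the three determinants does not depend on the orientations.
    have key : ∀ k x y : F × F, ∀ a b c : F, a * a = 1 → b * b = 1 → c * c = 1 →
        0 < (a * b * det2 k x) * (a * c * det2 k y) * (b * c * det2 x y) →
        0 < det2 k x * det2 k y * det2 x y := by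
      intro k x y a b c ha hb hc h
      convert h using 1
      linear_combination (-(det2 k x * det2 k y * det2 x y)) *
        ((b * b) * (c * c) * ha + (c * c) * hb + hc)
    refine key _ _ _ _ _ _ (hsq (e t₀)) (hsq (e (s + t₀))) (hsq (e (t + t₀))) ?_
    rcases fin_rotate_cases (t₀ := t₀) hs hst with ⟨h1, h2⟩ | ⟨h1, h2⟩ | ⟨h1, h2⟩
    · exact mul_pos (mul_pos (hlt _ _ h1) (hlt _ _ (h1.trans h2))) (hlt _ _ h2)
    · exact mul_pos (mul_pos_of_neg_of_neg (hgt _ _ (h1.trans h2)) (hgt _ _ h2)) (hlt _ _ h1)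
    · exact mul_pos_of_neg_of_neg (mul_neg_of_pos_of_neg (hlt _ _ h2) (hgt _ _ h1))
        (hgt _ _ (h1.trans h2))

theorem perm_eq_of_sorted {r : Fin n → Fin n → Prop} (hr : ∀ x y, r x y → ¬ r y x)
    {e e' : Equiv.Perm (Fin n)} (he : ∀ s t, s < t → r (e s) (e t))
    (he' : ∀ s t, s < t → r (e' s) (e' t)) : e = e' := by
  have hmono : StrictMono (e.trans e'.symm) := by
    intro s t hst
    rcases lt_trichotomy (e.trans e'.symm s) (e.trans e'.symm t) with h | h | h
    · exact h
    · exact absurd ((e.trans e'.symm).injective h) hst.ne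
    · have := he' _ _ h
      simp only [Equiv.trans_apply, Equiv.apply_symm_apply] at this
      exact absurd this (hr _ _ (he s t hst))
  ext1 t
  have : e.trans e'.symm t = t := hmono.apply_eq
  simp only [Equiv.trans_apply, Equiv.symm_apply_eq] at this
  exact this

theorem eq_of_succ_eq {α : Type*} {f g : Fin n → α} {σ : α → α} (h0 : f 0 = g 0)
    (hf : ∀ t, σ (f t) = f (t + 1)) (hg : ∀ t, σ (g t) = g (t + 1)) : f = g := by
  have key : ∀ (m : ℕ) (t : Fin n), t.val = m → f t = g t := by
    intro m
    induction m with
    | zero => intro t ht; rwa [show t = 0 from Fin.ext ht]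
    | succ m ih =>
      intro t ht
      have ht0 : t ≠ 0 := by rintro rfl; simp at ht
      have h := ih (t - 1) (by rw [Fin.val_sub_one_of_ne_zero ht0]; omega)
      have h1 := hf (t - 1)
      rw [h, hg] at h1
      simpa using h1.symm
  exact funext fun t => key _ t rfl

/-- Arrangements whose sides are ordered in the same way have the same cycle at infinity. -/
theorem IsCycleAtInfinity.eq_of_before {ℒ' : Fin n → PlaneLine F} {A' : Fin n → F × F}
    (hℒ : IsLineArrangement ℒ) (hA : IsVertexCycle ℒ A) (hℒ' : IsLineArrangement ℒ')
    (hA' : IsVertexCycle ℒ' A') {σ σ' : Equiv.Perm (Fin n)} (hσ : IsCycleAtInfinity ℒ σ)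
    (hσ' : IsCycleAtInfinity ℒ' σ') (h : ∀ x y, Before A' 0 x y → Before A 0 x y) : σ = σ' := by
  obtain ⟨e, -, he, hlt⟩ := hσ.exists_sorted hℒ hA 0
  obtain ⟨e', -, he', hlt'⟩ := hσ'.exists_sorted hℒ' hA' 0
  obtain rfl := perm_eq_of_sorted (r := Before A 0) (fun _ _ h => h.asymm) hlt
    fun s t hst => h _ _ (hlt' s t hst)
  ext1 x
  obtain ⟨t, rfl⟩ := e.surjective x
  rw [he, he']

theorem IsSwitch.isTwoStandardAt_iff (hn : 3 ≤ n) (hℒ : IsLineArrangement ℒ)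
    (hA : IsVertexCycle ℒ A) (hs : IsSwitch A k s) {σ : Equiv.Perm (Fin n)}
    (hσ : IsCycleAtInfinity ℒ σ) (j : Fin n) : IsTwoStandardAt (renumber k σ) j ↔ j = s := by
  obtain ⟨e, he0, heσ, hlt⟩ := hσ.exists_sorted hℒ hA k
  have hplace : ∀ e' : Equiv.Perm (Fin n), (∀ t, k + e' t = e t) →
      ∀ x y, e'.symm x < e'.symm y ↔ Before A k (k + x) (k + y) := by
    intro e' he' x y
    obtain ⟨a, rfl⟩ := e'.surjective x
    obtain ⟨b, rfl⟩ := e'.surjective y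
    simp only [Equiv.symm_apply_apply, he']
    refine ⟨hlt a b, fun h => ?_⟩
    rcases lt_trichotomy a b with hab | hab | hab
    · exact hab
    · subst hab; exact absurd h h.asymm
    · exact absurd h (hlt b a hab).asymm
  have hren : ∀ x, k + renumber k σ x = σ (k + x) := fun x => by simp [renumber]
  constructor
  · rintro ⟨e', he'0, he'σ, -, h1, h2, -⟩
    have he' : (fun t => k + e' t) = e := eq_of_succ_eq (σ := σ) (by simp [he'0, he0])
      (fun t => by rw [← hren, he'σ]) heσ
    have hp := hplace e' (congrFun he')
    exact hs.eq_of_runs hn hA (fun x y hxy hy => (hp x y).1 (h1 x y hxy hy))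
      fun x y hx hxy => (hp x y).1 (h2 x y hx hxy)
  · rintro rfl
    have hp := hplace (e.trans (Equiv.addLeft k).symm) fun t => by simp
    refine ⟨e.trans (Equiv.addLeft k).symm, by simp [he0], fun t => ?_,
      Fin.pos_iff_ne_zero.2 hs.ne_zero,
      fun x y hxy hy => (hp x y).2 (hs.before hn hA hxy (.inl hy)),
      fun x y hx hxy => (hp x y).2 (hs.before hn hA hxy (.inr hx)), fun h => ?_⟩
    · apply add_left_cancel (a := k)
      rw [hren]
      simp [heσ]
    · exact ((hp _ _).1 (h (j - 1) j hs.sub_one_lt)).asymm (hs.before_sub_one hn hA)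

end Infinity

section Isomorphism

variable {F : Type*} [Field F] [LinearOrder F] [IsStrictOrderedRing F]
variable {n : ℕ} [NeZero n] {ℒ ℒ' : Fin n → PlaneLine F} {A A' : Fin n → F × F}

/-! ### The directions determine the arrangement -/

theorem sign_det2_eq_of_isSwitch {s : Fin n → Fin n} (hs : ∀ k, IsSwitch A k (s k))
    (hs' : ∀ k, IsSwitch A' k (s k)) (i j : Fin n) :
    SignType.sign (det2 (side A i) (side A j)) = SignType.sign (det2 (side A' i) (side A' j)) := by
  obtain ⟨x, rfl⟩ : ∃ x, j = i + x := ⟨j - i, by simp⟩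
  by_cases hx : x = 0
  · simp [hx, det2_self]
  rcases lt_or_ge x (s i) with h | h
  · rw [sign_pos ((hs i).1 x hx h), sign_pos ((hs' i).1 x hx h)]
  · rw [sign_neg ((hs i).2 x h), sign_neg ((hs' i).2 x h)]

theorem Before.of_sign_eq (hc : ∀ i j, SignType.sign (det2 (side A i) (side A j)) =
    SignType.sign (det2 (side A' i) (side A' j))) {k x y : Fin n} (h : Before A k x y) :
    Before A' k x y := by
  refine h.imp id fun ⟨hx, hy, h⟩ => ⟨hx, hy, ?_⟩
  rw [← sign_eq_one_iff] at h ⊢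
  rw [← h]
  simp only [sign_mul, hc]

theorem det3_rotate (g h k : F × F × F) : det3 g h k = det3 h k g := by
  simp only [det3, cross3, form_apply]; ring

/-- Three sides, two of whose pairs turn in the same direction, bound a triangle of the
corresponding orientation: evaluate Cramer's rule at a point of the common side of the two pairs. -/
theorem IsVertexCycle.sign_det3 (hn : 3 ≤ n) (hA : IsVertexCycle ℒ A) {i j k : Fin n}
    (hik : i ≠ k) (hjk : j ≠ k)
    (h : SignType.sign (det2 (side A j) (side A k)) = SignType.sign (det2 (side A k) (side A i))) :
    SignType.sign (det3 (sideForm A i) (sideForm A j) (sideForm A k)) =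
      SignType.sign (det2 (side A j) (side A k)) := by
  obtain ⟨p, hp, hpos⟩ := hA.exists_mem_side hn k
  rw [det3_sideForm A i j k p, hp, mul_zero, add_zero]
  have hi := hpos i hik
  have hj := hpos j hjk
  rcases lt_or_gt_of_ne (hA.det_ne_zero j k hjk) with h1 | h1
  · rw [sign_neg h1] at h ⊢
    rw [sign_neg]
    exact add_neg (mul_neg_of_neg_of_pos h1 hi)
      (mul_neg_of_neg_of_pos (sign_eq_neg_one_iff.1 h.symm) hj)
  · rw [sign_pos h1] at h ⊢
    rw [sign_pos]
    exact add_pos (mul_pos h1 hi) (mul_pos (sign_eq_one_iff.1 h.symm) hj)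

theorem sign_det3_sideForm_eq (hn : 3 ≤ n) (hA : IsVertexCycle ℒ A) (hA' : IsVertexCycle ℒ' A')
    (hc : ∀ i j, SignType.sign (det2 (side A i) (side A j)) =
      SignType.sign (det2 (side A' i) (side A' j))) (i j k : Fin n) :
    SignType.sign (det3 (sideForm A i) (sideForm A j) (sideForm A k)) =
      SignType.sign (det3 (sideForm A' i) (sideForm A' j) (sideForm A' k)) := by
  have hz : ∀ g h : F × F × F, det3 g g h = 0 := fun g h => by
    simp only [det3, cross3, form_apply]; ring
  by_cases hij : i = j
  · rw [hij, hz, hz]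
  by_cases hjk : j = k
  · rw [hjk, det3_rotate, hz, det3_rotate, hz]
  by_cases hik : i = k
  · rw [hik, ← det3_rotate, hz, ← det3_rotate, hz]
  have hne : ∀ i j, i ≠ j → SignType.sign (det2 (side A i) (side A j)) ≠ 0 := fun i j hij =>
    sign_ne_zero.2 (hA.det_ne_zero i j hij)
  -- Of three nonzero signs, two agree.
  have hpigeon : ∀ a b c : SignType, a ≠ 0 → b ≠ 0 → c ≠ 0 → a = b ∨ b = c ∨ c = a := by decide
  rcases hpigeon _ _ _ (hne j k hjk) (hne k i (Ne.symm hik)) (hne i j hij) with h | h | h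
  · rw [hA.sign_det3 hn hik hjk h, hA'.sign_det3 hn hik hjk (by rw [← hc, ← hc, h]), hc]
  · rw [det3_rotate, det3_rotate (sideForm A' i), hA.sign_det3 hn (Ne.symm hij) (Ne.symm hik) h,
      hA'.sign_det3 hn (Ne.symm hij) (Ne.symm hik) (by rw [← hc, ← hc, h]), hc]
  · rw [← det3_rotate, ← det3_rotate (sideForm A' k), hA.sign_det3 hn (Ne.symm hjk) hij h,
      hA'.sign_det3 hn (Ne.symm hjk) hij (by rw [← hc, ← hc, h]), hc]

theorem IsVertexCycle.essential (hn : 3 ≤ n) (hA : IsVertexCycle ℒ A) (x : F × F × F)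
    (h : ∀ i, form (withInfinity (sideForm A) i) x = 0) : x = 0 := by
  have h1 := h none
  have h2 := h (some 0)
  have h3 := h (some 1)
  simp only [withInfinity, sideForm, form_apply, zero_mul, one_mul, zero_add] at h1 h2 h3
  have h4 := hA.det_ne_zero 0 1 (fin_one_ne_zero hn).symm
  rw [h1] at h2 h3
  refine Prod.ext (mul_left_cancel₀ h4 ?_) (Prod.ext (mul_left_cancel₀ h4 ?_) h1)
  · simp only [det2, Prod.fst_zero]
    linear_combination (side A 1).1 * h2 - (side A 0).1 * h3
  · simp only [det2, Prod.fst_zero, Prod.snd_zero]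
    linear_combination (side A 1).2 * h2 - (side A 0).2 * h3

theorem isomorphic_of_sign_eq (hn : 3 ≤ n) (hA : IsVertexCycle ℒ A) (hA' : IsVertexCycle ℒ' A')
    (hc : ∀ i j, SignType.sign (det2 (side A i) (side A j)) =
      SignType.sign (det2 (side A' i) (side A' j))) : Isomorphic ℒ ℒ' := by
  have hdet : ∀ B : Fin n → F × F,
      (∀ i j, det3 (0, 0, 1) (sideForm B i) (sideForm B j) = det2 (side B i) (side B j)) ∧
      (∀ i j, det3 (sideForm B i) (0, 0, 1) (sideForm B j) = det2 (side B j) (side B i)) ∧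
      ∀ i j, det3 (sideForm B i) (sideForm B j) (0, 0, 1) = det2 (side B i) (side B j) := by
    intro B
    refine ⟨fun i j => ?_, fun i j => ?_, fun i j => ?_⟩ <;>
    · simp only [det3, cross3, form_apply, sideForm, det2]; ring
  obtain ⟨φ, hφ, hsign⟩ := exists_piecewiseLinear_equiv (g := sideForm A) (g' := sideForm A')
    (hA.essential hn) (hA'.essential hn) (by
      rintro (_ | i) (_ | j) (_ | k) <;> simp only [withInfinity]
      · simp [det3, cross3, form_apply]
      · simp [det3, cross3, form_apply]
      · rw [(hdet A).1, (hdet A').1, hc]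
      · simp [det3, cross3, form_apply]
      · rw [(hdet A).2.1, (hdet A').2.1, hc]
      · rw [(hdet A).2.2, (hdet A').2.2, hc]
      · exact sign_det3_sideForm_eq hn hA hA' hc i j k)
  refine ⟨φ, hφ, congrArg Set.range (funext fun i => ?_)⟩
  have hmem : ∀ p, φ p ∈ (ℒ' i).points ↔ p ∈ (ℒ i).points := fun p => by
    rw [(hA'.direction i).mem_points_iff (hA'.mem i), (hA.direction i).mem_points_iff (hA.mem i),
      ← form_sideForm, ← form_sideForm, ← sign_eq_zero_iff, hsign, sign_eq_zero_iff]
  ext q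
  obtain ⟨p, rfl⟩ := φ.surjective q
  rw [φ.injective.mem_set_image, hmem]

end Isomorphism

end LineArr

theorem mainTheorem8 {F : Type*} [Field F] [LinearOrder F] [IsStrictOrderedRing F]
    {n : ℕ} [NeZero n] (hn : 3 ≤ n)
    (ℒ : Fin n → LineArr.PlaneLine F)
    (hℒ : LineArr.IsLineArrangement ℒ) (hgon : LineArr.IsAnticlockwiseGon ℒ) :
    -- the cycle at infinity and the opposite vertex of every side are well defined
    (∃! σ : Equiv.Perm (Fin n), LineArr.IsCycleAtInfinity ℒ σ) ∧
    (∀ k : Fin n, ∃! j : Fin n, LineArr.IsOppositeVertex ℒ k j) ∧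
    -- for every cyclic renumbering, the cycle at infinity has exactly one 2-standard consecutive
    -- structure; it respects the slope property, and it gives the opposite vertex of the first side
    (∀ σ : Equiv.Perm (Fin n), LineArr.IsCycleAtInfinity ℒ σ → ∀ k : Fin n,
      (∃! s : Fin n, LineArr.IsTwoStandardAt (LineArr.renumber k σ) s) ∧
      ∀ s : Fin n, LineArr.IsTwoStandardAt (LineArr.renumber k σ) s →
        LineArr.RespectsSlopeProperty (fun i => ℒ (k + i)) s ∧
        LineArr.IsOppositeVertex ℒ k (k + s - 1)) ∧
    -- the cycle at infinity and the opposite vertices of all sides determine each other, and they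
    -- determine the arrangement up to isomorphism
    (∀ ℒ' : Fin n → LineArr.PlaneLine F,
      LineArr.IsLineArrangement ℒ' → LineArr.IsAnticlockwiseGon ℒ' →
      ∀ σ σ' : Equiv.Perm (Fin n),
        LineArr.IsCycleAtInfinity ℒ σ → LineArr.IsCycleAtInfinity ℒ' σ' →
        (σ = σ' → ∀ k j : Fin n,
          LineArr.IsOppositeVertex ℒ k j ↔ LineArr.IsOppositeVertex ℒ' k j) ∧
        ((∀ k j : Fin n, LineArr.IsOppositeVertex ℒ k j ↔ LineArr.IsOppositeVertex ℒ' k j) →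
          σ = σ' ∧ LineArr.Isomorphic ℒ ℒ')) := by
  obtain ⟨A, hA⟩ := LineArr.exists_isVertexCycle hn hℒ hgon
  choose s hs using hA.exists_isSwitch hn
  have hopp := fun k j => (hs k).isOppositeVertex_iff hn hA j
  refine ⟨?_, fun k => ⟨k + s k - 1, (hopp k _).2 (by simp), fun j hj => ?_⟩, fun σ hσ k => ?_, ?_⟩
  · obtain ⟨σ, hσ⟩ := LineArr.exists_isCycleAtInfinity hℒ
    exact ⟨σ, hσ, fun σ' hσ' =>
      LineArr.IsCycleAtInfinity.eq_of_before hℒ hA hℒ hA hσ' hσ fun _ _ h => h⟩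
  · rw [← (hopp k j).1 hj]
    simp
  · have htwo := (hs k).isTwoStandardAt_iff hn hℒ hA hσ
    refine ⟨⟨s k, (htwo _).2 rfl, fun j hj => (htwo j).1 hj⟩, fun j hj => ?_⟩
    obtain rfl := (htwo j).1 hj
    exact ⟨((hs k).hasSlopeStructure_iff hn hA _).2 rfl, (hopp k _).2 (by simp)⟩
  · intro ℒ' hℒ' hgon' σ σ' hσ hσ'
    obtain ⟨A', hA'⟩ := LineArr.exists_isVertexCycle hn hℒ' hgon'
    choose s' hs' using hA'.exists_isSwitch hn
    have hopp' := fun k j => (hs' k).isOppositeVertex_iff hn hA' j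
    refine ⟨?_, fun h => ?_⟩
    · rintro rfl k j
      have h1 := ((hs k).isTwoStandardAt_iff hn hℒ hA hσ (s k)).2 rfl
      rw [hopp, hopp', ((hs' k).isTwoStandardAt_iff hn hℒ' hA' hσ' (s k)).1 h1]
    · have hss : s' = s := funext fun k => by
        have h1 := (h k (k + s k - 1)).1 ((hopp k _).2 (by simp))
        rw [← (hopp' k _).1 h1]
        simp
      subst hss
      have hc := LineArr.sign_det2_eq_of_isSwitch hs hs'
      exact ⟨LineArr.IsCycleAtInfinity.eq_of_before hℒ hA hℒ' hA' hσ hσ' fun _ _ h =>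
        h.of_sign_eq fun i j => (hc i j).symm, LineArr.isomorphic_of_sign_eq hn hA hA' hc⟩
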